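/- Let $\hat X$ be a hyperelliptic Riemann surface, that is, a compact connected Riemann surface together with a $2:1$ ramified covering $R:\hat X\to\mathbb P^1(\mathbb C)$: a holomorphic map all of whose fibres consist of two points, except for finitely many fibres, which consist of a single (Weierstrass) point. (No lower bound on the genus is needed.) Let $C\subset\hat X$ be a countable closed set such that, for some $p\in\mathbb P^1(\mathbb C)$, the set $C$ contains the fibre $F=R^{-1}(p)$ and all accumulation points of $C$ in $\hat X$ lie in $F$. Then the open Riemann surface $\hat X\setminus C$ admits a proper holomorphic embedding into $\mathbb C^2$, i.e. there is a proper injective holomorphic immersion $\hat X\setminus C\to\mathbb C^2$. -/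

import Mathlib

open scoped Manifold ContDiff

noncomputable section

/-- The affine coordinate `z` on the Riemann sphere `ℂ ∪ {∞}`; its value at `∞` is irrelevant. -/
def sphereCoord (w : OnePoint ℂ) : ℂ := w.elim 0 id

/-- The coordinate `1 / z` at infinity on the Riemann sphere `ℂ ∪ {∞}`, equal to `0` at `∞`;
its value at `z = 0` is irrelevant. -/
def sphereCoordInfty (w : OnePoint ℂ) : ℂ := w.elim 0 (fun z => z⁻¹)

/-- A holomorphic map from a Riemann surface `X` to the Riemann sphere: a continuous map which is
holomorphic when read in the two standard coordinates `z` and `1 / z` of the sphere. -/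
structure IsHolomorphicToSphere {X : Type*} [TopologicalSpace X] [ChartedSpace ℂ X]
    (R : X → OnePoint ℂ) : Prop where
  continuous : Continuous R
  mdifferentiableAt_of_ne_infty : ∀ x : X, R x ≠ OnePoint.infty →
    MDifferentiableAt 𝓘(ℂ) 𝓘(ℂ) (fun x' => sphereCoord (R x')) x
  mdifferentiableAt_of_eq_infty : ∀ x : X, R x = OnePoint.infty →
    MDifferentiableAt 𝓘(ℂ) 𝓘(ℂ) (fun x' => sphereCoordInfty (R x')) x

/-- A `2 : 1` ramified covering of the Riemann sphere: a holomorphic map all of whose fibres consist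
of two points, except for finitely many fibres, which consist of a single point. A compact connected
Riemann surface with such a map is hyperelliptic, and the single-point fibres are its Weierstrass
points (no lower bound on the genus is imposed here). -/
structure IsTwoToOneCovering {X : Type*} [TopologicalSpace X] [ChartedSpace ℂ X]
    (R : X → OnePoint ℂ) : Prop where
  holomorphic : IsHolomorphicToSphere R
  ncard_fibre : ∀ p : OnePoint ℂ, (R ⁻¹' {p}).ncard = 1 ∨ (R ⁻¹' {p}).ncard = 2
  finite_branch : {p : OnePoint ℂ | (R ⁻¹' {p}).ncard ≠ 2}.Finite

/-- A proper holomorphic embedding of a Riemann surface `M` into a complex vector space `E`: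
a proper holomorphic immersion which is a homeomorphism onto its image. -/
structure IsProperHolomorphicEmbedding {M : Type*} [TopologicalSpace M] [ChartedSpace ℂ M]
    {E : Type*} [NormedAddCommGroup E] [NormedSpace ℂ E] (φ : M → E) : Prop where
  holomorphic : MDifferentiable 𝓘(ℂ) 𝓘(ℂ, E) φ
  immersion : ∀ x : M, Function.Injective (mfderiv 𝓘(ℂ) 𝓘(ℂ, E) φ x)
  isEmbedding : Topology.IsEmbedding φ
  proper : IsProperMap φ

end

open Filter Topology Set

/-! A Möbius transformation sends `p` to infinity. Off the fibre `F` the covering becomes a proper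
holomorphic map `r` of degree two from `Y = X \ F` to the plane, with finitely many branch values,
and `D = C \ F` meets each preimage of a closed disc in a finite set.

Let `f` be entire with simple zeros exactly at the branch values. Then `Y` is the Riemann surface of
`√f`: `f ∘ r` has a holomorphic square root `y` taking distinct values at the two points of an
unbranched fibre and having simple zeros over the branch values (`exists_isRootOn_univ`). It exists
locally, is unique up to sign over connected open sets, and is continued along growing discs.

Let `g` be entire with simple zeros exactly on `r(D)`. By interpolation there is an entire `a` such
that `u = a(r) + y` is nonzero on `D` but vanishes at every point over `r(D)` outside `D`. The
quotient `h = u / g(r)` is then holomorphic off `D` with poles on `D`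
(`exists_function_with_poles`). The pair `(r, h)` is injective because `y` separates fibres and a
fibre meeting `D` has at most one point outside it. It is immersive because, off `D`, `r'` vanishes
only over branch values, where `y' ≠ 0`. It is proper because bounding `r` confines a point to a
compact part of `Y`, and bounding `h` keeps it away from `D` (`exists_embedding`). -/

/-! ### Local behaviour of analytic germs. -/

/-- A nonvanishing analytic germ has an analytic `n`-th root. -/
theorem AnalyticAt.exists_nthRoot {u : ℂ → ℂ} {t₀ : ℂ} (hu : AnalyticAt ℂ u t₀) (h0 : u t₀ ≠ 0)
    {n : ℕ} (hn : n ≠ 0) :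
    ∃ v : ℂ → ℂ, AnalyticAt ℂ v t₀ ∧ v t₀ ≠ 0 ∧ ∀ᶠ t in 𝓝 t₀, v t ^ n = u t := by
  obtain ⟨c, hc⟩ := IsAlgClosed.exists_pow_nat_eq (u t₀) (Nat.pos_of_ne_zero hn)
  have hc0 : c ≠ 0 := by
    rintro rfl
    exact h0 (by rw [← hc, zero_pow hn])
  have hq : AnalyticAt ℂ (fun t => u t / u t₀) t₀ := hu.div analyticAt_const h0
  have hs : u t₀ / u t₀ ∈ Complex.slitPlane := by rw [div_self h0]; exact Complex.one_mem_slitPlane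
  refine ⟨fun t => c * Complex.exp (Complex.log (u t / u t₀) / n), ?_, ?_, ?_⟩
  · exact analyticAt_const.mul
      ((hq.clog hs).div analyticAt_const (Nat.cast_ne_zero.mpr hn)).cexp
  · exact mul_ne_zero hc0 (Complex.exp_ne_zero _)
  · have hne : ∀ᶠ t in 𝓝 t₀, u t ≠ 0 := hu.continuousAt.eventually_ne h0
    filter_upwards [hne] with t ht
    rw [mul_pow, ← Complex.exp_nat_mul, mul_div_cancel₀ _ (Nat.cast_ne_zero.mpr hn),
      Complex.exp_log (div_ne_zero ht h0), hc, mul_div_cancel₀ _ h0]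

/-- Local normal form of a nonconstant analytic germ: up to a constant it is a power of a local
coordinate. -/
theorem AnalyticAt.exists_eq_pow_of_not_const {f : ℂ → ℂ} {t₀ : ℂ} (hf : AnalyticAt ℂ f t₀)
    (hnc : ¬ ∀ᶠ t in 𝓝 t₀, f t = f t₀) :
    ∃ n : ℕ, n ≠ 0 ∧ ∃ ψ : ℂ → ℂ, AnalyticAt ℂ ψ t₀ ∧ ψ t₀ = 0 ∧ deriv ψ t₀ ≠ 0 ∧
      ∀ᶠ t in 𝓝 t₀, f t = f t₀ + ψ t ^ n := by
  have hf' : AnalyticAt ℂ (fun t => f t - f t₀) t₀ := hf.sub analyticAt_const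
  obtain ⟨n, g, hg, hg0, hfg⟩ := hf'.exists_eventuallyEq_pow_smul_nonzero_iff.mpr (by
    intro h
    exact hnc (h.mono fun t ht => sub_eq_zero.mp ht))
  have hn : n ≠ 0 := by
    rintro rfl
    have := hfg.self_of_nhds
    simp at this
    exact hg0 this.symm
  obtain ⟨v, hv, hv0, hvg⟩ := hg.exists_nthRoot hg0 hn
  refine ⟨n, hn, fun t => (t - t₀) * v t, (analyticAt_id.sub analyticAt_const).mul hv, by simp,
    ?_, ?_⟩
  · have h1 : HasDerivAt (fun t => t - t₀) 1 t₀ := (hasDerivAt_id t₀).sub_const t₀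
    have := h1.mul hv.differentiableAt.hasDerivAt
    have h2 := this.deriv
    simp only [sub_self, one_mul, zero_mul, add_zero] at h2
    change deriv ((fun t => t - t₀) * v) t₀ ≠ 0
    rw [h2]; exact hv0
  · filter_upwards [hfg, hvg] with t ht hvt
    rw [mul_pow, hvt, ← smul_eq_mul, ← ht]; ring

/-- A germ with nonzero derivative is open. -/
theorem AnalyticAt.nhds_le_map_of_deriv_ne_zero {ψ : ℂ → ℂ} {t₀ : ℂ} (hψ : AnalyticAt ℂ ψ t₀)
    (h : deriv ψ t₀ ≠ 0) : 𝓝 (ψ t₀) ≤ map ψ (𝓝 t₀) := by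
  rcases hψ.eventually_constant_or_nhds_le_map_nhds with h1 | h1
  · exfalso
    apply h
    have : ψ =ᶠ[𝓝 t₀] fun _ => ψ t₀ := h1
    rw [this.deriv_eq, deriv_const]
  · exact h1

/-- Near a point where `f` is an `n`-th power of a local coordinate, up to a constant, some value
is taken at `n` distinct points. -/
theorem exists_injective_of_eq_pow {f ψ : ℂ → ℂ} {t₀ : ℂ} {n : ℕ} (hn : n ≠ 0)
    (hψ : AnalyticAt ℂ ψ t₀) (h0 : ψ t₀ = 0) (hd : deriv ψ t₀ ≠ 0)
    (hf : ∀ᶠ t in 𝓝 t₀, f t = f t₀ + ψ t ^ n) {N : Set ℂ} (hN : N ∈ 𝓝 t₀) :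
    ∃ τ : Fin n → ℂ, Function.Injective τ ∧ (∀ k, τ k ∈ N) ∧ ∃ c, ∀ k, f (τ k) = c := by
  have hN' : N ∩ {t | f t = f t₀ + ψ t ^ n} ∈ 𝓝 t₀ := inter_mem hN hf
  have him := hψ.nhds_le_map_of_deriv_ne_zero hd (image_mem_map hN')
  rw [h0] at him
  obtain ⟨δ, hδ, hball⟩ := Metric.mem_nhds_iff.mp him
  -- The points `ζ ^ k * (δ / 2)` are distinct with the same `n`-th power; their preimages under `ψ`
  -- are the required points.
  let ζ := Complex.exp (2 * Real.pi * Complex.I / n)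
  have hζ : IsPrimitiveRoot ζ n := Complex.isPrimitiveRoot_exp n hn
  have hnorm : ‖ζ‖ = 1 := Complex.norm_eq_one_of_pow_eq_one hζ.pow_eq_one hn
  have hs0 : ((δ / 2 : ℝ) : ℂ) ≠ 0 := by
    exact_mod_cast (half_pos hδ).ne'
  have hmem : ∀ k : Fin n, ζ ^ (k : ℕ) * ((δ / 2 : ℝ) : ℂ) ∈
      ψ '' (N ∩ {t | f t = f t₀ + ψ t ^ n}) := by
    intro k
    apply hball
    rw [mem_ball_zero_iff, norm_mul, norm_pow, hnorm, one_pow, one_mul, Complex.norm_real,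
      Real.norm_of_nonneg (half_pos hδ).le]
    exact half_lt_self hδ
  choose τ hτ hτψ using hmem
  refine ⟨τ, fun i j hij => ?_, fun k => (hτ k).1, f t₀ + ((δ / 2 : ℝ) : ℂ) ^ n, fun k => ?_⟩
  · have := congrArg ψ hij
    rw [hτψ, hτψ] at this
    exact Fin.ext (hζ.pow_inj i.2 j.2 (mul_right_cancel₀ hs0 this))
  · rw [(hτ k).2, hτψ, mul_pow, ← pow_mul, mul_comm (k : ℕ) n, pow_mul, hζ.pow_eq_one, one_pow,
      one_mul]

/-- An injective analytic germ has nonzero derivative. -/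
theorem AnalyticAt.deriv_ne_zero_of_injOn {f : ℂ → ℂ} {t₀ : ℂ} (hf : AnalyticAt ℂ f t₀)
    {N : Set ℂ} (hN : N ∈ 𝓝 t₀) (hinj : InjOn f N) : deriv f t₀ ≠ 0 := by
  have hnc : ¬ ∀ᶠ t in 𝓝 t₀, f t = f t₀ := by
    intro h
    have h1 : ∀ᶠ t in 𝓝[≠] t₀, f t = f t₀ ∧ t ∈ N :=
      (h.and hN).filter_mono nhdsWithin_le_nhds
    obtain ⟨t, ⟨h2, h3⟩, h4⟩ := (h1.and self_mem_nhdsWithin).exists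
    exact h4 (hinj h3 (mem_of_mem_nhds hN) h2)
  obtain ⟨n, hn, ψ, hψ, h0, hd, hfψ⟩ := hf.exists_eq_pow_of_not_const hnc
  obtain ⟨τ, hτ, hτN, c, hc⟩ := exists_injective_of_eq_pow hn hψ h0 hd hfψ hN
  have h1 : n = 1 := by
    by_contra h1
    have h2 : 1 < n := by omega
    have := hτ (hinj (hτN ⟨0, by omega⟩) (hτN ⟨1, h2⟩) ((hc _).trans (hc _).symm))
    simp at this
  subst h1
  have : f =ᶠ[𝓝 t₀] fun t => f t₀ + ψ t := hfψ.mono fun t ht => by simpa using ht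
  rw [this.deriv_eq, deriv_const_add]
  exact hd

/-! ### Connected open plane sets minus finitely many points. -/

theorem isPreconnected_ball_diff_singleton (b : ℂ) (ε : ℝ) (hε : 0 < ε) :
    IsPreconnected (Metric.ball b ε \ {b}) := by
  have h1 : IsPreconnected ({0}ᶜ : Set ℂ) :=
    (isConnected_compl_singleton_of_one_lt_rank
      (Complex.rank_real_complex ▸ Nat.one_lt_ofNat) _).isPreconnected
  let e := OpenPartialHomeomorph.univBall b ε
  have he : e '' {0}ᶜ = Metric.ball b ε \ {b} := by
    have hsrc : e.source = univ := OpenPartialHomeomorph.univBall_source b ε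
    have htgt : e.target = Metric.ball b ε := OpenPartialHomeomorph.univBall_target b hε
    have h0 : e 0 = b := OpenPartialHomeomorph.univBall_apply_zero b ε
    ext z
    constructor
    · rintro ⟨t, ht, rfl⟩
      refine ⟨htgt ▸ e.map_source (hsrc ▸ mem_univ t), fun h => ht ?_⟩
      exact e.injOn (hsrc ▸ mem_univ _) (hsrc ▸ mem_univ _) (h.trans h0.symm)
    · rintro ⟨hz, hzb⟩
      rw [← htgt] at hz
      refine ⟨e.symm z, fun h => hzb ?_, e.right_inv hz⟩
      rw [mem_singleton_iff] at h
      rw [← e.right_inv hz, h, h0]; rfl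
  rw [← he]
  exact h1.image _ ((OpenPartialHomeomorph.continuous_univBall b ε).continuousOn)

/-- In a separation of `V \ {b}`, a small punctured disc about `b` lies on one side; adding the
whole disc to that side would separate `V`. -/
theorem IsPreconnected.diff_singleton_of_isOpen {V : Set ℂ} (hV : IsPreconnected V)
    (hVo : IsOpen V) (b : ℂ) : IsPreconnected (V \ {b}) := by
  by_cases hb : b ∈ V
  swap
  · rwa [sdiff_singleton_eq_self hb]
  obtain ⟨ε, hε, hball⟩ := Metric.isOpen_iff.mp hVo b hb
  have hpun := isPreconnected_ball_diff_singleton b ε hε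
  have key : ∀ S T : Set ℂ, IsOpen S → IsOpen T → V \ {b} ⊆ S ∪ T → (V \ {b} ∩ S).Nonempty →
      (V \ {b} ∩ T).Nonempty → (V \ {b} ∩ (S ∩ T)) = ∅ → Metric.ball b ε \ {b} ⊆ S → False := by
    intro S T hS hT hcov hSn hTn hdis hsub
    have hT' : IsOpen (T \ {b}) := hT.sdiff isClosed_singleton
    obtain ⟨x, hx⟩ := hSn
    obtain ⟨y, hy⟩ := hTn
    obtain ⟨z, hzV, hzS, hzT⟩ := hV (S ∪ Metric.ball b ε) (T \ {b}) (hS.union Metric.isOpen_ball)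
      hT' (by
        intro z hz
        by_cases hzb : z = b
        · left; right; rw [hzb]; exact Metric.mem_ball_self hε
        · rcases hcov ⟨hz, hzb⟩ with h | h
          · exact Or.inl (Or.inl h)
          · exact Or.inr ⟨h, hzb⟩) ⟨x, hx.1.1, Or.inl hx.2⟩ ⟨y, hy.1.1, hy.2, hy.1.2⟩
    have hzS' : z ∈ S := by
      rcases hzS with h | h
      · exact h
      · exact hsub ⟨h, hzT.2⟩
    have : z ∈ V \ {b} ∩ (S ∩ T) := ⟨⟨hzV, hzT.2⟩, hzS', hzT.1⟩
    rw [hdis] at this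
    exact this
  intro S T hS hT hcov hSn hTn
  by_contra hdis
  rw [not_nonempty_iff_eq_empty] at hdis
  have hsub' : Metric.ball b ε \ {b} ⊆ V \ {b} := sdiff_subset_sdiff_left hball
  rcases (isPreconnected_iff_subset_of_disjoint.mp hpun) S T hS hT (hsub'.trans hcov)
    (by
      rw [← subset_empty_iff, ← hdis]
      exact inter_subset_inter_left _ hsub') with h | h
  · exact key S T hS hT hcov hSn hTn hdis h
  · exact key T S hT hS (by rwa [union_comm]) hTn hSn (by rwa [inter_comm T S]) h

theorem IsPreconnected.diff_finite_of_isOpen {V B : Set ℂ} (hV : IsPreconnected V)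
    (hVo : IsOpen V) (hB : B.Finite) : IsPreconnected (V \ B) := by
  induction B, hB using Set.Finite.induction_on with
  | empty => simpa using hV
  | @insert b B _ hB ih =>
    rw [← union_singleton, ← sdiff_sdiff]
    exact ih.diff_singleton_of_isOpen (hVo.sdiff hB.isClosed) b

/-! ### Weierstrass products and interpolation by entire functions. -/

/-- Weierstrass elementary factors, of a degree chosen to be close to `1` on half the disc. -/
theorem exists_elementary_factor {a : ℂ} (ha : a ≠ 0) {δ : ℝ} (hδ : 0 < δ) :
    ∃ e : ℂ → ℂ, Differentiable ℂ e ∧ e a = 0 ∧ deriv e a ≠ 0 ∧ (∀ z, z ≠ a → e z ≠ 0) ∧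
      ∀ z, ‖z‖ ≤ ‖a‖ / 2 → ‖e z - 1‖ ≤ δ := by
  -- On the half disc the logarithm of the factor is at most `(1 / 2) ^ n`. The bound by `1` permits
  -- `‖exp w - 1‖ ≤ 2 ‖w‖`, and the bound by `δ / 2` absorbs that factor `2`.
  obtain ⟨n, hn⟩ := exists_pow_lt_of_lt_one (lt_min one_pos (half_pos hδ)) (one_half_lt_one (α := ℝ))
  have hE : Differentiable ℂ fun z : ℂ => Complex.exp (-Complex.logTaylor (n + 1) (-z / a)) := by
    have h1 : Differentiable ℂ (Complex.logTaylor (n + 1)) := fun z =>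
      (Complex.hasDerivAt_logTaylor n z).differentiableAt
    exact (h1.comp ((differentiable_id.neg).div_const a)).neg.cexp
  refine ⟨fun z => (1 - z / a) * Complex.exp (-Complex.logTaylor (n + 1) (-z / a)), ?_, ?_, ?_,
    ?_, ?_⟩
  · exact ((differentiable_const 1).sub (differentiable_id.div_const a)).mul hE
  · simp [ha]
  · have h1 : HasDerivAt (fun z : ℂ => 1 - z / a) (-(1 / a)) a :=
      ((hasDerivAt_id a).div_const a).const_sub 1
    have h2 := (h1.mul (hE a).hasDerivAt).deriv
    rw [div_self ha, sub_self, zero_mul, add_zero] at h2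
    change deriv ((fun z : ℂ => 1 - z / a) *
      fun z : ℂ => Complex.exp (-Complex.logTaylor (n + 1) (-z / a))) a ≠ 0
    rw [h2]
    exact mul_ne_zero (neg_ne_zero.mpr (one_div_ne_zero ha)) (Complex.exp_ne_zero _)
  · intro z hz
    refine mul_ne_zero (fun h => hz ?_) (Complex.exp_ne_zero _)
    rw [sub_eq_zero, eq_comm, div_eq_one_iff_eq ha] at h
    exact h
  · intro z hz
    have hw : ‖-z / a‖ ≤ 1 / 2 := by
      rw [norm_div, norm_neg, div_le_iff₀ (norm_pos_iff.mpr ha)]; linarith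
    set w := -z / a with hwdef
    have h1 : 1 - z / a = 1 + w := by rw [hwdef]; ring
    have h2 : 1 + w ≠ 0 := by
      intro h
      have : w = -1 := by linear_combination h
      rw [this] at hw
      norm_num at hw
    have h3 : (1 - z / a) * Complex.exp (-Complex.logTaylor (n + 1) w)
        = Complex.exp (Complex.log (1 + w) - Complex.logTaylor (n + 1) w) := by
      rw [sub_eq_add_neg, sub_eq_add_neg, Complex.exp_add, Complex.exp_log h2, ← h1, sub_eq_add_neg]
    have h4 : ‖Complex.log (1 + w) - Complex.logTaylor (n + 1) w‖ ≤ (1 / 2) ^ n := by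
      refine (Complex.norm_log_sub_logTaylor_le n (by linarith)).trans ?_
      have h5 : (1 - ‖w‖)⁻¹ ≤ 2 := by
        rw [inv_le_comm₀ (by linarith) two_pos]; linarith
      have h6 : ‖w‖ ^ (n + 1) ≤ (1 / 2) ^ (n + 1) := pow_le_pow_left₀ (norm_nonneg _) hw _
      calc ‖w‖ ^ (n + 1) * (1 - ‖w‖)⁻¹ / (n + 1) ≤ ‖w‖ ^ (n + 1) * (1 - ‖w‖)⁻¹ := by
            apply div_le_self
            · have : 0 ≤ (1 - ‖w‖)⁻¹ := inv_nonneg.mpr (by linarith)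
              positivity
            · have : (0 : ℝ) ≤ n := n.cast_nonneg
              linarith
        _ ≤ (1 / 2) ^ (n + 1) * 2 :=
            mul_le_mul h6 h5 (inv_nonneg.mpr (by linarith)) (by positivity)
        _ = (1 / 2) ^ n := by rw [pow_succ]; ring
    dsimp only
    rw [← hwdef, h3]
    have h7 := lt_min_iff.mp hn
    refine (Complex.norm_exp_sub_one_le (h4.trans h7.1.le)).trans ?_
    linarith

section Families

variable {ι : Type*} {a : ι → ℂ} {δ : ι → ℝ} {f : ι → ℂ → ℂ}

/-- A fixed disc lies in the half disc of radius `‖a i‖ / 2` for all but finitely many `i`. This is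
what lets the Weierstrass M-test apply locally to the products and sums below. -/
theorem eventually_norm_le_of_tendsto (ha : Tendsto (fun i => ‖a i‖) cofinite atTop)
    (hb : ∀ i z, ‖z‖ ≤ ‖a i‖ / 2 → ‖f i z‖ ≤ δ i) (ρ : ℝ) :
    ∀ᶠ i in cofinite, ∀ z ∈ Metric.ball (0 : ℂ) ρ, ‖f i z‖ ≤ δ i := by
  filter_upwards [ha.eventually_ge_atTop (2 * ρ)] with i hi z hz
  rw [mem_ball_zero_iff] at hz
  exact hb i z (by linarith)

theorem summable_norm_of_tendsto (ha : Tendsto (fun i => ‖a i‖) cofinite atTop)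
    (hδ : Summable δ) (hb : ∀ i z, ‖z‖ ≤ ‖a i‖ / 2 → ‖f i z‖ ≤ δ i) (z : ℂ) :
    Summable fun i => ‖f i z‖ := by
  refine Summable.of_norm_bounded_eventually hδ ?_
  filter_upwards [eventually_norm_le_of_tendsto ha hb (‖z‖ + 1)] with i hi
  rw [norm_norm]
  exact hi z (by rw [mem_ball_zero_iff]; linarith)

theorem differentiable_tprod_of_tendsto (ha : Tendsto (fun i => ‖a i‖) cofinite atTop)
    (hδ : Summable δ) (hb : ∀ i z, ‖z‖ ≤ ‖a i‖ / 2 → ‖f i z‖ ≤ δ i)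
    (hf : ∀ i, Differentiable ℂ (f i)) : Differentiable ℂ fun z => ∏' i, (1 + f i z) := by
  intro z
  have h1 := Summable.hasProdLocallyUniformlyOn_one_add (Metric.isOpen_ball (x := (0 : ℂ)) (ε := ‖z‖ + 1))
    hδ (eventually_norm_le_of_tendsto ha hb _) fun i => (hf i).continuous.continuousOn
  have h2 := h1.differentiableOn (.of_forall fun s => by
    simpa [Finset.prod_fn] using
      DifferentiableOn.finsetProd (fun i _ => ((differentiable_const 1).add (hf i)).differentiableOn))
    Metric.isOpen_ball
  exact h2.differentiableAt (Metric.isOpen_ball.mem_nhds (by rw [mem_ball_zero_iff]; linarith))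

theorem differentiable_tsum_of_tendsto (ha : Tendsto (fun i => ‖a i‖) cofinite atTop)
    (hδ : Summable δ) (hb : ∀ i z, ‖z‖ ≤ ‖a i‖ / 2 → ‖f i z‖ ≤ δ i)
    (hf : ∀ i, Differentiable ℂ (f i)) : Differentiable ℂ fun z => ∑' i, f i z := by
  intro z
  have h1 := (tendstoUniformlyOn_tsum_of_cofinite_eventually hδ
    (eventually_norm_le_of_tendsto ha hb (‖z‖ + 1))).tendstoLocallyUniformlyOn
  have h2 := h1.differentiableOn (.of_forall fun s =>
    DifferentiableOn.fun_sum fun i _ => (hf i).differentiableOn) Metric.isOpen_ball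
  exact h2.differentiableAt (Metric.isOpen_ball.mem_nhds (by rw [mem_ball_zero_iff]; linarith))

end Families

section DiscreteSet

variable {E : Set ℂ}

theorem tendsto_norm_cofinite_of_finite_inter (hE : ∀ M : ℝ, (E ∩ Metric.closedBall 0 M).Finite) :
    Tendsto (fun i : E => ‖(i : ℂ)‖) cofinite atTop := by
  rw [tendsto_atTop]
  intro M
  have h : Set.Finite {i : E | ¬ M ≤ ‖(i : ℂ)‖} := by
    refine Set.Finite.of_finite_image (f := Subtype.val) ((hE M).subset ?_)
      Subtype.val_injective.injOn
    rintro _ ⟨i, hi, rfl⟩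
    refine ⟨i.2, ?_⟩
    rw [mem_closedBall_zero_iff]
    exact (not_le.mp hi).le
  exact h

theorem countable_of_finite_inter (hE : ∀ M : ℝ, (E ∩ Metric.closedBall 0 M).Finite) :
    E.Countable := by
  have : E = ⋃ n : ℕ, E ∩ Metric.closedBall 0 n := by
    rw [← inter_iUnion, Metric.iUnion_closedBall_nat, inter_univ]
  rw [this]
  exact countable_iUnion fun n => (hE n).countable

/-- Summable positive weights on a locally finite subset of the plane. -/
theorem exists_summable_weights (hE : ∀ M : ℝ, (E ∩ Metric.closedBall 0 M).Finite) :
    ∃ δ : E → ℝ, (∀ i, 0 < δ i) ∧ Summable δ := by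
  have := (countable_of_finite_inter hE).to_subtype
  obtain ⟨enc, henc⟩ := exists_injective_nat E
  exact ⟨fun i => (1 / 2) ^ enc i, fun i => by positivity,
    summable_geometric_two.comp_injective henc⟩

/-- Weierstrass: an entire function with simple zeros on a given locally finite set, and no other
zeros. -/
theorem exists_entire_simple_zeros_of_zero_notMem (h0 : (0 : ℂ) ∉ E)
    (hE : ∀ M : ℝ, (E ∩ Metric.closedBall 0 M).Finite) :
    ∃ g : ℂ → ℂ, Differentiable ℂ g ∧ (∀ z, g z = 0 ↔ z ∈ E) ∧ ∀ z ∈ E, deriv g z ≠ 0 := by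
  classical
  obtain ⟨δ, hδ0, hδ⟩ := exists_summable_weights hE
  have hne : ∀ i : E, (i : ℂ) ≠ 0 := fun i h => h0 (h ▸ i.2)
  choose e he he0 hed hene heb using fun i : E => exists_elementary_factor (hne i) (hδ0 i)
  have ha := tendsto_norm_cofinite_of_finite_inter hE
  let f : E → ℂ → ℂ := fun i z => e i z - 1
  have hfd : ∀ i, Differentiable ℂ (f i) := fun i => (he i).sub_const 1
  have hsum := summable_norm_of_tendsto ha hδ heb
  -- Splitting off the factor at `c` leaves a product obeying the same bounds, none of whose factors
  -- vanishes at `c`. Hence the zero at `c` is exactly that of `e c`.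
  have key : ∀ c : E, ∃ h : ℂ → ℂ, Differentiable ℂ h ∧ h c ≠ 0 ∧
      ∀ z, ∏' i, (1 + f i z) = e c z * h z := by
    intro c
    let f' : E → ℂ → ℂ := fun i z => if i = c then 0 else f i z
    have hb' : ∀ (i : E) (z : ℂ), ‖z‖ ≤ ‖(i : ℂ)‖ / 2 → ‖f' i z‖ ≤ δ i := by
      intro i z hz
      by_cases hi : i = c
      · simp [f', hi, (hδ0 c).le]
      · simpa [f', hi] using heb i z hz
    refine ⟨fun z => ∏' i, (1 + f' i z), differentiable_tprod_of_tendsto ha hδ hb' fun i => ?_,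
      ?_, fun z => ?_⟩
    · by_cases hi : i = c
      · simp [f', hi]
      · simpa [f', hi] using hfd i
    · refine tprod_one_add_ne_zero_of_summable (fun i => ?_) (summable_norm_of_tendsto ha hδ hb' c)
      by_cases hi : i = c
      · simp [f', hi]
      · have : (c : ℂ) ≠ i := fun h => hi (Subtype.ext h.symm)
        simpa [f', hi, f] using hene i c this
    · have hm : Multipliable (Function.update (fun i => 1 + f i z) c 1) := by
        have := multipliable_one_add_of_summable (summable_norm_of_tendsto ha hδ hb' z)
        refine this.congr fun i => ?_
        by_cases hi : i = c
        · subst hi; simp [f']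
        · simp [f', hi]
      rw [hm.tprod_eq_mul_tprod_ite']
      congr 1
      · simp [f]
      · refine tprod_congr fun i => ?_
        by_cases hi : i = c <;> simp [f', hi]
  refine ⟨fun z => ∏' i, (1 + f i z), differentiable_tprod_of_tendsto ha hδ heb hfd,
    fun z => ⟨fun hz => ?_, fun hz => ?_⟩, fun z hz => ?_⟩
  · by_contra hzE
    refine tprod_one_add_ne_zero_of_summable (fun i => ?_) (hsum z) hz
    simpa [f] using hene i z fun h => hzE (h ▸ i.2)
  · obtain ⟨h, -, -, heq⟩ := key ⟨z, hz⟩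
    dsimp only
    rw [heq z, he0 ⟨z, hz⟩, zero_mul]
  · obtain ⟨h, hd, hhz, heq⟩ := key ⟨z, hz⟩
    have h1 := (((he ⟨z, hz⟩ z).hasDerivAt).mul (hd z).hasDerivAt).deriv
    rw [he0 ⟨z, hz⟩, zero_mul, add_zero] at h1
    have h2 : (fun z => ∏' i, (1 + f i z)) = e ⟨z, hz⟩ * h := funext heq
    rw [h2, h1]
    exact mul_ne_zero (hed ⟨z, hz⟩) hhz

/-- A Lagrange series: with `g` having simple zeros on `E`, the function `g z / (g' i * (z - i))` is
`1` at `i` and `0` at the other points of `E`. The factor `(z / i) ^ k` is `1` at `i` and forces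
convergence. -/
theorem exists_entire_interpolation_of_zero_notMem (h0 : (0 : ℂ) ∉ E)
    (hE : ∀ M : ℝ, (E ∩ Metric.closedBall 0 M).Finite) (c : ℂ → ℂ) :
    ∃ A : ℂ → ℂ, Differentiable ℂ A ∧ ∀ z ∈ E, A z = c z := by
  obtain ⟨g, hg, hgE, hgd⟩ := exists_entire_simple_zeros_of_zero_notMem h0 hE
  obtain ⟨δ, hδ0, hδ⟩ := exists_summable_weights hE
  have hne : ∀ i : E, (i : ℂ) ≠ 0 := fun i h => h0 (h ▸ i.2)
  have ha := tendsto_norm_cofinite_of_finite_inter hE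
  -- Writing the quotient with `dslope` fills in the removable singularity at `i`.
  let L : E → ℂ → ℂ := fun i z => c i / deriv g i * dslope g i z
  have hL : ∀ i, Differentiable ℂ (L i) := by
    intro i
    have : DifferentiableOn ℂ (dslope g i) univ :=
      (Complex.differentiableOn_dslope univ_mem).mpr hg.differentiableOn
    exact (differentiableOn_univ.mp this).const_mul _
  have hk : ∀ i : E, ∃ k : ℕ, k ≠ 0 ∧
      ∀ z, ‖z‖ ≤ ‖(i : ℂ)‖ / 2 → ‖L i z * (z / i) ^ k‖ ≤ δ i := by
    intro i
    obtain ⟨M, hM⟩ := (isCompact_closedBall (0 : ℂ) (‖(i : ℂ)‖ / 2)).exists_bound_of_continuousOn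
      (hL i).continuous.continuousOn
    have hM0 : 0 ≤ M := (norm_nonneg _).trans (hM 0 (Metric.mem_closedBall_self (by positivity)))
    obtain ⟨k, hk⟩ := exists_pow_lt_of_lt_one (div_pos (hδ0 i) (by linarith : 0 < M + 1))
      (one_half_lt_one (α := ℝ))
    refine ⟨k + 1, k.succ_ne_zero, fun z hz => ?_⟩
    have h1 : ‖z / i‖ ≤ 1 / 2 := by
      rw [norm_div, div_le_iff₀ (norm_pos_iff.mpr (hne i))]; linarith
    rw [norm_mul, norm_pow]
    calc ‖L i z‖ * ‖z / i‖ ^ (k + 1) ≤ (M + 1) * (1 / 2) ^ (k + 1) := by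
          gcongr
          exact (hM z (by simpa using hz)).trans (by linarith)
      _ ≤ (M + 1) * (1 / 2) ^ k :=
          mul_le_mul_of_nonneg_left (pow_le_pow_of_le_one (by norm_num) (by norm_num) k.le_succ)
            (by linarith)
      _ ≤ δ i := by
          rw [lt_div_iff₀ (by linarith)] at hk; linarith
  choose k hk0 hkb using hk
  let f : E → ℂ → ℂ := fun i z => L i z * (z / i) ^ k i
  refine ⟨fun z => ∑' i, f i z, differentiable_tsum_of_tendsto ha hδ hkb fun i =>
    (hL i).mul ((differentiable_id.div_const _).pow _), fun z hz => ?_⟩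
  dsimp only
  rw [tsum_eq_single (⟨z, hz⟩ : E)]
  · simp only [f, L, dslope_same]
    rw [div_mul_cancel₀ _ (hgd z hz), div_self (hne ⟨z, hz⟩), one_pow, mul_one]
  · intro i hi
    have hzi : z ≠ i := fun h => hi (Subtype.ext h.symm)
    simp only [f, L]
    rw [dslope_of_ne _ hzi, slope_def_field, (hgE z).mpr hz, (hgE i).mpr i.2]
    simp

/-- The elementary factors and the powers `(z / i) ^ k` need nonzero nodes; a translation removes
this restriction, since `E` is countable. -/
theorem exists_translate_avoiding (hE : ∀ M : ℝ, (E ∩ Metric.closedBall 0 M).Finite) :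
    ∃ s : ℂ, (0 : ℂ) ∉ (fun z => z + s) ⁻¹' E ∧
      ∀ M : ℝ, ((fun z => z + s) ⁻¹' E ∩ Metric.closedBall 0 M).Finite := by
  obtain ⟨s, hs⟩ := ((countable_of_finite_inter hE).dense_compl ℂ).nonempty
  refine ⟨s, by simpa using hs, fun M => ?_⟩
  refine Set.Finite.of_finite_image (f := fun z => z + s) ((hE (M + ‖s‖)).subset ?_)
    (add_left_injective s).injOn
  rintro _ ⟨z, ⟨hzE, hzM⟩, rfl⟩
  refine ⟨hzE, ?_⟩
  rw [mem_closedBall_zero_iff] at hzM ⊢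
  exact (norm_add_le _ _).trans (by linarith)

/-- Weierstrass: an entire function with simple zeros on a given locally finite set, and no other
zeros. -/
theorem exists_entire_simple_zeros (hE : ∀ M : ℝ, (E ∩ Metric.closedBall 0 M).Finite) :
    ∃ g : ℂ → ℂ, Differentiable ℂ g ∧ (∀ z, g z = 0 ↔ z ∈ E) ∧ ∀ z ∈ E, deriv g z ≠ 0 := by
  obtain ⟨s, hs, hE'⟩ := exists_translate_avoiding hE
  obtain ⟨g, hg, hgE, hgd⟩ := exists_entire_simple_zeros_of_zero_notMem hs hE'
  refine ⟨fun z => g (z - s), hg.comp (differentiable_id.sub_const s), fun z => ?_, fun z hz => ?_⟩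
  · rw [hgE]; simp
  · rw [deriv_comp_sub_const]
    exact hgd _ (by simpa using hz)

/-- Interpolation by entire functions on a locally finite set. -/
theorem exists_entire_interpolation (hE : ∀ M : ℝ, (E ∩ Metric.closedBall 0 M).Finite)
    (c : ℂ → ℂ) : ∃ A : ℂ → ℂ, Differentiable ℂ A ∧ ∀ z ∈ E, A z = c z := by
  obtain ⟨s, hs, hE'⟩ := exists_translate_avoiding hE
  obtain ⟨A, hA, hAE⟩ := exists_entire_interpolation_of_zero_notMem hs hE' fun z => c (z + s)
  refine ⟨fun z => A (z - s), hA.comp (differentiable_id.sub_const s), fun z hz => ?_⟩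
  dsimp only
  rw [hAE _ (by simpa using hz), sub_add_cancel]

end DiscreteSet

/-! ### Derivatives read in the preferred chart. -/

section ChartDeriv

variable {Y : Type*} [TopologicalSpace Y] [ChartedSpace ℂ Y]

/-- The derivative of a function on a Riemann surface in the preferred chart at a point. -/
noncomputable def chartDeriv (g : Y → ℂ) (x : Y) : ℂ :=
  deriv (g ∘ (chartAt ℂ x).symm) (chartAt ℂ x x)

theorem tendsto_chartAt_symm (x : Y) :
    Tendsto (chartAt ℂ x).symm (𝓝 (chartAt ℂ x x)) (𝓝 x) := by
  have h := (chartAt ℂ x).continuousAt_symm (mem_chart_target ℂ x)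
  rwa [ContinuousAt, (chartAt ℂ x).left_inv (mem_chart_source ℂ x)] at h

theorem chartDeriv_congr {g h : Y → ℂ} {x : Y} (hgh : g =ᶠ[𝓝 x] h) :
    chartDeriv g x = chartDeriv h x :=
  Filter.EventuallyEq.deriv_eq ((tendsto_chartAt_symm x).eventually hgh)

theorem MDifferentiableAt.differentiableAt_comp_chart {g : Y → ℂ} {x : Y}
    (hg : MDifferentiableAt 𝓘(ℂ) 𝓘(ℂ) g x) :
    DifferentiableAt ℂ (g ∘ (chartAt ℂ x).symm) (chartAt ℂ x x) := by
  have h := hg.differentiableWithinAt_writtenInExtChartAt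
  simpa [writtenInExtChartAt, differentiableWithinAt_univ, chartAt_self_eq] using! h

theorem MDifferentiableAt.hasDerivAt_comp_chart {g : Y → ℂ} {x : Y}
    (hg : MDifferentiableAt 𝓘(ℂ) 𝓘(ℂ) g x) :
    HasDerivAt (g ∘ (chartAt ℂ x).symm) (chartDeriv g x) (chartAt ℂ x x) :=
  hg.differentiableAt_comp_chart.hasDerivAt

theorem chartDeriv_neg (g : Y → ℂ) (x : Y) : chartDeriv (fun x => -g x) x = -chartDeriv g x :=
  deriv.fun_neg

theorem chartDeriv_comp {g : Y → ℂ} {x : Y} (hg : MDifferentiableAt 𝓘(ℂ) 𝓘(ℂ) g x) {s : ℂ → ℂ}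
    (hs : DifferentiableAt ℂ s (g x)) :
    chartDeriv (fun x => s (g x)) x = deriv s (g x) * chartDeriv g x := by
  have hx : (g ∘ (chartAt ℂ x).symm) (chartAt ℂ x x) = g x := by
    simp [(chartAt ℂ x).left_inv (mem_chart_source ℂ x)]
  have h1 : HasDerivAt s (deriv s (g x)) ((g ∘ (chartAt ℂ x).symm) (chartAt ℂ x x)) := by
    rw [hx]; exact hs.hasDerivAt
  exact (h1.comp _ hg.hasDerivAt_comp_chart).deriv

theorem chartDeriv_mul {g h : Y → ℂ} {x : Y} (hg : MDifferentiableAt 𝓘(ℂ) 𝓘(ℂ) g x)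
    (hh : MDifferentiableAt 𝓘(ℂ) 𝓘(ℂ) h x) :
    chartDeriv (fun x => g x * h x) x = chartDeriv g x * h x + g x * chartDeriv h x := by
  have h1 := (hg.hasDerivAt_comp_chart.mul hh.hasDerivAt_comp_chart).deriv
  simp only [Function.comp_apply, (chartAt ℂ x).left_inv (mem_chart_source ℂ x)] at h1
  exact h1

theorem chartDeriv_add {g h : Y → ℂ} {x : Y} (hg : MDifferentiableAt 𝓘(ℂ) 𝓘(ℂ) g x)
    (hh : MDifferentiableAt 𝓘(ℂ) 𝓘(ℂ) h x) :
    chartDeriv (fun x => g x + h x) x = chartDeriv g x + chartDeriv h x :=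
  (hg.hasDerivAt_comp_chart.add hh.hasDerivAt_comp_chart).deriv

variable [IsManifold 𝓘(ℂ) ω Y]

theorem MDifferentiableAt.differentiableAt_comp_chart_symm {g : Y → ℂ} {x : Y} {t : ℂ}
    (ht : t ∈ (chartAt ℂ x).target)
    (hg : MDifferentiableAt 𝓘(ℂ) 𝓘(ℂ) g ((chartAt ℂ x).symm t)) :
    DifferentiableAt ℂ (g ∘ (chartAt ℂ x).symm) t := by
  have : IsManifold 𝓘(ℂ) 1 Y := IsManifold.of_le (n := ω) le_top
  exact (hg.comp t (mdifferentiableAt_atlas_symm (chart_mem_atlas ℂ x) ht)).differentiableAt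

theorem analyticAt_comp_chart_symm {g : Y → ℂ} {x : Y}
    (hg : ∀ᶠ x' in 𝓝 x, MDifferentiableAt 𝓘(ℂ) 𝓘(ℂ) g x') :
    AnalyticAt ℂ (g ∘ (chartAt ℂ x).symm) (chartAt ℂ x x) := by
  rw [Complex.analyticAt_iff_eventually_differentiableAt]
  filter_upwards [(tendsto_chartAt_symm x).eventually hg,
    (chartAt ℂ x).open_target.mem_nhds (mem_chart_target ℂ x)] with t h1 h2
  exact h1.differentiableAt_comp_chart_symm h2

theorem mdifferentiableAt_comp_chartAt {G : ℂ → ℂ} {x x' : Y}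
    (hx' : x' ∈ (chartAt ℂ x).source) (hG : DifferentiableAt ℂ G (chartAt ℂ x x')) :
    MDifferentiableAt 𝓘(ℂ) 𝓘(ℂ) (fun x' => G (chartAt ℂ x x')) x' := by
  have : IsManifold 𝓘(ℂ) 1 Y := IsManifold.of_le (n := ω) le_top
  exact MDifferentiableAt.comp x' hG.mdifferentiableAt
    (mdifferentiableAt_atlas (chart_mem_atlas ℂ x) hx')

end ChartDeriv

/-! ### Proper double covers of the plane and their local structure. -/

theorem exists_ne_of_ncard_fibre_eq_two {Y : Type*} {r : Y → ℂ} {z : ℂ} (hz : (r ⁻¹' {z}).ncard = 2) :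
    ∃ x₁ x₂, x₁ ≠ x₂ ∧ r x₁ = z ∧ r x₂ = z := by
  obtain ⟨x₁, x₂, hne, h⟩ := Set.ncard_eq_two.mp hz
  have h1 : x₁ ∈ r ⁻¹' {z} := by rw [h]; simp
  have h2 : x₂ ∈ r ⁻¹' {z} := by rw [h]; simp
  exact ⟨x₁, x₂, hne, h1, h2⟩

/-- A holomorphic proper map of degree two to the plane, with finitely many branch values. -/
structure IsProperDoubleCover {Y : Type*} [TopologicalSpace Y] [ChartedSpace ℂ Y]
    (r : Y → ℂ) : Prop where
  mdifferentiable : MDifferentiable 𝓘(ℂ) 𝓘(ℂ) r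
  isCompact_preimage : ∀ M : ℝ, IsCompact (r ⁻¹' Metric.closedBall 0 M)
  ncard_fibre : ∀ z : ℂ, (r ⁻¹' {z}).ncard = 1 ∨ (r ⁻¹' {z}).ncard = 2
  finite_branch : {z : ℂ | (r ⁻¹' {z}).ncard ≠ 2}.Finite

namespace IsProperDoubleCover

variable {Y : Type*} [TopologicalSpace Y] [ChartedSpace ℂ Y] {r : Y → ℂ}

theorem continuous (hr : IsProperDoubleCover r) : Continuous r := hr.mdifferentiable.continuous

theorem finite_fibre (hr : IsProperDoubleCover r) (z : ℂ) : (r ⁻¹' {z}).Finite := by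
  apply Set.finite_of_ncard_ne_zero
  rcases hr.ncard_fibre z with h | h <;> rw [h] <;> norm_num

theorem nonempty_fibre (hr : IsProperDoubleCover r) (z : ℂ) : ∃ x, r x = z := by
  have : (r ⁻¹' {z}).Nonempty := by
    apply Set.nonempty_of_ncard_ne_zero
    rcases hr.ncard_fibre z with h | h <;> rw [h] <;> norm_num
  exact this

theorem eq_of_three (hr : IsProperDoubleCover r) {x₁ x₂ x₃ : Y} (h₂ : r x₂ = r x₁)
    (h₃ : r x₃ = r x₁) (h12 : x₁ ≠ x₂) : x₃ = x₁ ∨ x₃ = x₂ := by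
  by_contra! h
  have hsub : ({x₃, x₁, x₂} : Set Y) ⊆ r ⁻¹' {r x₁} := by
    rintro x (rfl | rfl | rfl) <;> simp [h₂, h₃]
  have h3 : ({x₃, x₁, x₂} : Set Y).ncard = 3 := by
    rw [Set.ncard_eq_three]
    exact ⟨x₃, x₁, x₂, h.1, h.2, h12, rfl⟩
  have := Set.ncard_le_ncard hsub (hr.finite_fibre _)
  rcases hr.ncard_fibre (r x₁) with h' | h' <;> omega

theorem ncard_eq_two_of_ne (hr : IsProperDoubleCover r) {x₁ x₂ : Y} (hne : x₁ ≠ x₂)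
    (h : r x₂ = r x₁) : (r ⁻¹' {r x₁}).ncard = 2 := by
  rcases hr.ncard_fibre (r x₁) with h1 | h1
  · obtain ⟨w, hw⟩ := Set.ncard_eq_one.mp h1
    have e1 : x₁ ∈ ({w} : Set Y) := by rw [← hw]; simp
    have e2 : x₂ ∈ ({w} : Set Y) := by rw [← hw]; simp [h]
    exact absurd (e1.trans e2.symm) hne
  · exact h1

theorem eq_of_ncard_ne_two (hr : IsProperDoubleCover r) {x₁ x₂ : Y} (h : r x₂ = r x₁)
    (hb : (r ⁻¹' {r x₁}).ncard ≠ 2) : x₁ = x₂ := by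
  by_contra hne
  exact hb (hr.ncard_eq_two_of_ne hne h)

/-- A neighbourhood of a whole fibre contains the fibres over a neighbourhood of its base point. -/
theorem exists_preimage_subset [T2Space Y] (hr : IsProperDoubleCover r) {z : ℂ} {N : Set Y}
    (hN : IsOpen N) (hz : r ⁻¹' {z} ⊆ N) : ∃ W : Set ℂ, IsOpen W ∧ z ∈ W ∧ r ⁻¹' W ⊆ N := by
  have hK : IsCompact (r ⁻¹' Metric.closedBall 0 (‖z‖ + 1) \ N) :=
    (hr.isCompact_preimage _).diff hN
  have hcl : IsClosed (r '' (r ⁻¹' Metric.closedBall 0 (‖z‖ + 1) \ N)) :=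
    (hK.image hr.continuous).isClosed
  refine ⟨Metric.ball 0 (‖z‖ + 1) \ r '' (r ⁻¹' Metric.closedBall 0 (‖z‖ + 1) \ N),
    Metric.isOpen_ball.sdiff hcl, ⟨by simp, ?_⟩, ?_⟩
  · rintro ⟨x, ⟨-, hx⟩, hxz⟩
    exact hx (hz hxz)
  · rintro x ⟨hx1, hx2⟩
    by_contra hxN
    exact hx2 ⟨x, ⟨Metric.ball_subset_closedBall hx1, hxN⟩, rfl⟩

/-- Otherwise a whole neighbourhood would lie in one fibre, which is finite. -/
theorem not_eventually_const (hr : IsProperDoubleCover r) (x : Y) :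
    ¬ ∀ᶠ t in 𝓝 (chartAt ℂ x x), (r ∘ (chartAt ℂ x).symm) t =
      (r ∘ (chartAt ℂ x).symm) (chartAt ℂ x x) := by
  intro h
  have h1 := inter_mem h ((chartAt ℂ x).open_target.mem_nhds (mem_chart_target ℂ x))
  refine infinite_of_mem_nhds _ h1 ?_
  refine Set.Finite.of_finite_image (f := (chartAt ℂ x).symm) ?_
    ((chartAt ℂ x).symm.injOn.mono inter_subset_right)
  refine (hr.finite_fibre (r x)).subset ?_
  rintro _ ⟨t, ⟨ht, -⟩, rfl⟩
  have ht' : r ((chartAt ℂ x).symm t) = r ((chartAt ℂ x).symm (chartAt ℂ x x)) := ht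
  rw [(chartAt ℂ x).left_inv (mem_chart_source ℂ x)] at ht'
  exact ht'

variable [IsManifold 𝓘(ℂ) ω Y]

theorem analyticAt (hr : IsProperDoubleCover r) (x : Y) :
    AnalyticAt ℂ (r ∘ (chartAt ℂ x).symm) (chartAt ℂ x x) :=
  analyticAt_comp_chart_symm (.of_forall hr.mdifferentiable)

theorem nhds_le_map (hr : IsProperDoubleCover r) (x : Y) : 𝓝 (r x) ≤ map r (𝓝 x) := by
  rcases (hr.analyticAt x).eventually_constant_or_nhds_le_map_nhds with h | h
  · exact absurd h (hr.not_eventually_const x)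
  · rw [Function.comp_apply, (chartAt ℂ x).left_inv (mem_chart_source ℂ x), ← Filter.map_map] at h
    exact h.trans (Filter.map_mono (tendsto_chartAt_symm x))

theorem isOpenMap (hr : IsProperDoubleCover r) : IsOpenMap r :=
  IsOpenMap.of_nhds_le hr.nhds_le_map

/-- Over a neighbourhood of an unbranched value there are two disjoint sheets. -/
theorem exists_sheets [T2Space Y] (hr : IsProperDoubleCover r) {x₁ x₂ : Y} (hne : x₁ ≠ x₂)
    (h : r x₂ = r x₁) : ∃ N₁ N₂ : Set Y, IsOpen N₁ ∧ IsOpen N₂ ∧ x₁ ∈ N₁ ∧ x₂ ∈ N₂ ∧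
      Disjoint N₁ N₂ ∧ ∃ W : Set ℂ, IsOpen W ∧ r x₁ ∈ W ∧ (∀ x, r x ∈ W → x ∈ N₁ ∨ x ∈ N₂) ∧
      (∀ x x', r x ∈ W → r x' = r x → x ∈ N₁ → x' ∈ N₁ → x = x') ∧
      (∀ x x', r x ∈ W → r x' = r x → x ∈ N₂ → x' ∈ N₂ → x = x') := by
  obtain ⟨N₁, N₂, ho₁, ho₂, hx₁, hx₂, hd⟩ := t2_separation hne
  -- Over `r '' N₁ ∩ r '' N₂` every fibre meets both disjoint sets, and having at most two points it
  -- meets each exactly once.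
  refine ⟨N₁, N₂, ho₁, ho₂, hx₁, hx₂, hd, r '' N₁ ∩ r '' N₂,
    (hr.isOpenMap _ ho₁).inter (hr.isOpenMap _ ho₂), ⟨⟨x₁, hx₁, rfl⟩, ⟨x₂, hx₂, h⟩⟩, ?_, ?_, ?_⟩
  · rintro x ⟨⟨a, ha, hax⟩, ⟨b, hb, hbx⟩⟩
    have hab : a ≠ b := fun e => hd.notMem_of_mem_left ha (e ▸ hb)
    rcases hr.eq_of_three (hbx.trans hax.symm) hax.symm hab with e | e
    · exact Or.inl (e ▸ ha)
    · exact Or.inr (e ▸ hb)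
  · rintro x x' ⟨-, ⟨b, hb, hbx⟩⟩ hxx' hx hx'
    by_contra hc
    rcases hr.eq_of_three hxx' hbx hc with e | e
    · exact hd.notMem_of_mem_left hx (e ▸ hb)
    · exact hd.notMem_of_mem_left hx' (e ▸ hb)
  · rintro x x' ⟨⟨a, ha, hax⟩, -⟩ hxx' hx hx'
    by_contra hc
    rcases hr.eq_of_three hxx' hax hc with e | e
    · exact hd.notMem_of_mem_right hx (e ▸ ha)
    · exact hd.notMem_of_mem_right hx' (e ▸ ha)

/-- On its own sheet `r` is injective, and an injective analytic germ has nonzero derivative. -/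
theorem chartDeriv_ne_zero [T2Space Y] (hr : IsProperDoubleCover r) {x₁ x₂ : Y} (hne : x₁ ≠ x₂)
    (h : r x₂ = r x₁) : chartDeriv r x₁ ≠ 0 := by
  obtain ⟨N₁, -, ho₁, -, hx₁, -, -, W, hW, hxW, -, hinj, -⟩ := hr.exists_sheets hne h
  have hN : N₁ ∩ r ⁻¹' W ∈ 𝓝 x₁ :=
    (ho₁.inter (hW.preimage hr.continuous)).mem_nhds ⟨hx₁, hxW⟩
  refine (hr.analyticAt x₁).deriv_ne_zero_of_injOn (inter_mem (tendsto_chartAt_symm x₁ hN)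
    ((chartAt ℂ x₁).open_target.mem_nhds (mem_chart_target ℂ x₁))) ?_
  rintro t ⟨ht, htt⟩ t' ⟨ht', htt'⟩ heq
  exact (chartAt ℂ x₁).symm.injOn htt htt' (hinj _ _ ht.2 heq.symm ht.1 ht'.1)

theorem chartDeriv_ne_zero_of_ncard [T2Space Y] (hr : IsProperDoubleCover r) {x : Y}
    (h : (r ⁻¹' {r x}).ncard = 2) : chartDeriv r x ≠ 0 := by
  obtain ⟨x₁, x₂, hne, h1, h2⟩ := exists_ne_of_ncard_fibre_eq_two h
  rcases eq_or_ne x x₁ with rfl | hx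
  · exact hr.chartDeriv_ne_zero hne h2
  · exact hr.chartDeriv_ne_zero hx h1

/-- At the point over a branch value the covering is the square of a local coordinate. -/
theorem exists_eq_sq [T2Space Y] (hr : IsProperDoubleCover r) {w : Y}
    (hw : (r ⁻¹' {r w}).ncard ≠ 2) : ∃ N : Set Y, IsOpen N ∧ w ∈ N ∧ ∃ ψ : Y → ℂ,
      (∀ x ∈ N, MDifferentiableAt 𝓘(ℂ) 𝓘(ℂ) ψ x) ∧ InjOn ψ N ∧ ψ w = 0 ∧ chartDeriv ψ w ≠ 0 ∧
      ∀ x ∈ N, r x = r w + ψ x ^ 2 := by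
  set e := chartAt ℂ w with he
  have hew : e.symm (e w) = w := e.left_inv (mem_chart_source ℂ w)
  have ht0 : e.target ∈ 𝓝 (e w) := e.open_target.mem_nhds (mem_chart_target ℂ w)
  obtain ⟨n, hn, ψ, hψ, h0, hd, hfψ⟩ :=
    (hr.analyticAt w).exists_eq_pow_of_not_const (hr.not_eventually_const w)
  have hψinj : ∃ T ∈ 𝓝 (e w), InjOn ψ T := by
    have hs : HasStrictDerivAt ψ (deriv ψ (e w)) (e w) := hψ.hasStrictDerivAt
    have hs' := hs.hasStrictFDerivAt_equiv hd
    exact ⟨_, hs'.toOpenPartialHomeomorph.open_source.mem_nhds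
      hs'.mem_toOpenPartialHomeomorph_source, hs'.toOpenPartialHomeomorph.injOn⟩
  obtain ⟨T, hT, hTinj⟩ := hψinj
  -- Nearby fibres contain `n` points: `n > 2` contradicts the degree, and `n = 1` would make branch
  -- values accumulate.
  have hn2 : n = 2 := by
    have hle : n ≤ 2 := by
      by_contra hlt
      obtain ⟨τ, hτ, hτN, c, hc⟩ := exists_injective_of_eq_pow hn hψ h0 hd hfψ ht0
      have hne : ∀ i j : Fin n, i ≠ j → e.symm (τ i) ≠ e.symm (τ j) := fun i j hij h =>
        hij (hτ (e.symm.injOn (hτN i) (hτN j) h))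
      have heq : ∀ i j : Fin n, r (e.symm (τ i)) = r (e.symm (τ j)) := fun i j =>
        (hc i).trans (hc j).symm
      rcases hr.eq_of_three (heq ⟨1, by omega⟩ ⟨0, by omega⟩) (heq ⟨2, by omega⟩ ⟨0, by omega⟩)
        (hne _ _ (by simp)) with h | h
      · exact hne _ _ (by simp) h
      · exact hne _ _ (by simp) h
    have hne1 : n ≠ 1 := by
      rintro rfl
      -- `r` would be injective over a neighbourhood of `r w`, so all values there are branch values
      obtain ⟨T', hT'sub, hT'o, hT'w⟩ := mem_nhds_iff.mp (inter_mem (inter_mem hT hfψ) ht0)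
      have hNo : IsOpen (e.source ∩ e ⁻¹' T') := e.isOpen_inter_preimage hT'o
      obtain ⟨W, hWo, hzW, hWN⟩ := hr.exists_preimage_subset hNo (z := r w) (by
        intro x hx
        have : w = x := hr.eq_of_ncard_ne_two hx hw
        exact this ▸ ⟨mem_chart_source ℂ w, hT'w⟩)
      refine infinite_of_mem_nhds (r w) (hWo.mem_nhds hzW) (hr.finite_branch.subset fun z hz h2 => ?_)
      obtain ⟨x₁, x₂, hne, h1, h2⟩ := exists_ne_of_ncard_fibre_eq_two h2
      obtain ⟨hs1, ht1⟩ := hWN (show r x₁ ∈ W from h1 ▸ hz)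
      obtain ⟨hs2, ht2⟩ := hWN (show r x₂ ∈ W from h2 ▸ hz)
      have q1 := (hT'sub ht1).1.2
      have q2 := (hT'sub ht2).1.2
      simp only [mem_ofPred_eq, Function.comp_apply, ← he, e.left_inv hs1, e.left_inv hs2,
        pow_one] at q1 q2
      refine hne (e.injOn hs1 hs2 (hTinj (hT'sub ht1).1.1 (hT'sub ht2).1.1 ?_))
      have := h1.trans h2.symm
      rw [q1, q2] at this
      exact add_left_cancel this
    omega
  subst hn2
  have hda := hψ.eventually_analyticAt
  obtain ⟨T', hT'sub, hT'o, hT'w⟩ := mem_nhds_iff.mp (inter_mem (inter_mem hT hfψ) hda)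
  refine ⟨e.source ∩ e ⁻¹' T', e.isOpen_inter_preimage hT'o, ⟨mem_chart_source ℂ w, hT'w⟩,
    fun x => ψ (e x), ?_, ?_, h0, ?_, ?_⟩
  · rintro x ⟨hxs, hxT⟩
    exact mdifferentiableAt_comp_chartAt hxs (hT'sub hxT).2.differentiableAt
  · rintro x ⟨hxs, hxT⟩ x' ⟨hxs', hxT'⟩ h
    exact e.injOn hxs hxs' (hTinj (hT'sub hxT).1.1 (hT'sub hxT').1.1 h)
  · have : (fun x => ψ (e x)) ∘ (chartAt ℂ w).symm =ᶠ[𝓝 (chartAt ℂ w w)] ψ := by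
      filter_upwards [ht0] with t ht
      simp [← he, e.right_inv ht]
    rw [chartDeriv, this.deriv_eq]
    exact hd
  · rintro x ⟨hxs, hxT⟩
    have := (hT'sub hxT).1.2
    simpa only [mem_ofPred_eq, Function.comp_apply, ← he, e.left_inv hxs, hew] using this

end IsProperDoubleCover

/-! ### Square roots on the cover: gluing and uniqueness up to sign. -/

/-- `y` is a holomorphic square root of `f ∘ r` over `U` which separates the points of the fibres
of `r` and has simple zeros. -/
structure IsRootOn {Y : Type*} [TopologicalSpace Y] [ChartedSpace ℂ Y]
    (r : Y → ℂ) (f : ℂ → ℂ) (U : Set ℂ) (y : Y → ℂ) : Prop where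
  mdifferentiableAt : ∀ x, r x ∈ U → MDifferentiableAt 𝓘(ℂ) 𝓘(ℂ) y x
  sq : ∀ x, r x ∈ U → y x ^ 2 = f (r x)
  inj : ∀ x x', r x ∈ U → r x' = r x → y x = y x' → x = x'
  chartDeriv_ne_zero : ∀ x, r x ∈ U → f (r x) = 0 → chartDeriv y x ≠ 0

namespace IsRootOn

variable {Y : Type*} [TopologicalSpace Y] [ChartedSpace ℂ Y] {r : Y → ℂ} {f : ℂ → ℂ}
  {U V : Set ℂ} {y y' : Y → ℂ}

theorem mono (h : IsRootOn r f U y) (hV : V ⊆ U) : IsRootOn r f V y :=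
  ⟨fun x hx => h.mdifferentiableAt x (hV hx), fun x hx => h.sq x (hV hx),
    fun x x' hx => h.inj x x' (hV hx), fun x hx => h.chartDeriv_ne_zero x (hV hx)⟩

theorem neg (h : IsRootOn r f U y) : IsRootOn r f U fun x => -y x :=
  ⟨fun x hx => (h.mdifferentiableAt x hx).neg, fun x hx => by rw [neg_sq]; exact h.sq x hx,
    fun x x' hx hxx' e => h.inj x x' hx hxx' (neg_injective e), fun x hx h0 => by
      rw [chartDeriv_neg]; exact neg_ne_zero.mpr (h.chartDeriv_ne_zero x hx h0)⟩

/-- Each condition concerns a germ at one point or a single fibre, so it can be checked over small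
open sets of the base. -/
theorem of_local (hr : Continuous r) (h : ∀ z ∈ U, ∃ V, IsOpen V ∧ z ∈ V ∧ ∃ y', IsRootOn r f V y' ∧
    ∀ x, r x ∈ V → y x = y' x) : IsRootOn r f U y := by
  have hev : ∀ (V : Set ℂ) (y' : Y → ℂ), IsOpen V → (∀ x, r x ∈ V → y x = y' x) →
      ∀ x, r x ∈ V → y =ᶠ[𝓝 x] y' := fun V y' hV hy x hx =>
    Filter.eventually_of_mem ((hV.preimage hr).mem_nhds hx) hy
  refine ⟨fun x hx => ?_, fun x hx => ?_, fun x x' hx hxx' e => ?_, fun x hx h0 => ?_⟩ <;>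
    obtain ⟨V, hV, hxV, y', hy', heq⟩ := h _ hx
  · exact (hy'.mdifferentiableAt x hxV).congr_of_eventuallyEq (hev V y' hV heq x hxV)
  · rw [heq x hxV]; exact hy'.sq x hxV
  · rw [heq x hxV, heq x' (hxx' ▸ hxV)] at e
    exact hy'.inj x x' hxV hxx' e
  · rw [chartDeriv_congr (hev V y' hV heq x hxV)]
    exact hy'.chartDeriv_ne_zero x hxV h0

theorem ne_zero (h : IsRootOn r f U y) {x : Y} (hx : r x ∈ U) (h0 : f (r x) ≠ 0) : y x ≠ 0 := by
  intro e
  exact h0 (by rw [← h.sq x hx, e, zero_pow two_ne_zero])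

theorem eq_zero (h : IsRootOn r f U y) {x : Y} (hx : r x ∈ U) (h0 : f (r x) = 0) : y x = 0 :=
  pow_eq_zero_iff two_ne_zero |>.mp ((h.sq x hx).trans h0)

theorem eq_neg_of_ne (h : IsRootOn r f U y) {x x' : Y} (hx : r x ∈ U) (hxx' : r x' = r x)
    (hne : x ≠ x') : y x' = -y x := by
  have h1 : y x' ^ 2 = y x ^ 2 := by rw [h.sq x hx, h.sq x' (hxx' ▸ hx), hxx']
  rcases sq_eq_sq_iff_eq_or_eq_neg.mp h1 with e | e
  · exact absurd (h.inj x x' hx hxx' e.symm) hne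
  · exact e

theorem eq_or_eq_neg_at (h : IsRootOn r f U y) (h' : IsRootOn r f U y') {x : Y} (hx : r x ∈ U) :
    y x = y' x ∨ y x = -y' x :=
  sq_eq_sq_iff_eq_or_eq_neg.mp ((h.sq x hx).trans (h'.sq x hx).symm)

/-- Every such root changes sign between the two points of a fibre, so agreement of two roots
depends only on the base point. -/
theorem eq_of_eq (h : IsRootOn r f U y) (h' : IsRootOn r f U y') {x x' : Y} (hx : r x ∈ U)
    (hxx' : r x' = r x) (e : y x = y' x) : y x' = y' x' := by
  rcases eq_or_ne x x' with rfl | hne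
  · exact e
  · rw [h.eq_neg_of_ne hx hxx' hne, h'.eq_neg_of_ne hx hxx' hne, e]

/-- Where `f ≠ 0`, the values `y'` and `-y'` differ, so by continuity the choice of sign is locally
constant. -/
theorem isOpen_setOf_eq (h : IsRootOn r f U y) (h' : IsRootOn r f U y') (hr : Continuous r)
    (hU : IsOpen U) (hf : Continuous f) :
    IsOpen {x | (r x ∈ U ∧ f (r x) ≠ 0) ∧ y x = y' x} := by
  rw [isOpen_iff_mem_nhds]
  rintro x ⟨⟨hx, h0⟩, e⟩
  have hne : y x ≠ -y' x := by
    intro e'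
    apply h'.ne_zero hx h0
    have := e.symm.trans e'
    exact self_eq_neg.mp this
  have c := (h.mdifferentiableAt x hx).continuousAt
  have c' := (h'.mdifferentiableAt x hx).continuousAt
  have h1 : ∀ᶠ x' in 𝓝 x, y x' - -y' x' ≠ 0 :=
    (c.sub c'.neg).eventually_ne (sub_ne_zero.mpr hne)
  filter_upwards [h1, (hU.preimage hr).mem_nhds hx, (hf.comp hr).continuousAt.eventually_ne h0]
    with x' e1 e2 e3
  exact ⟨⟨e2, e3⟩, (h.eq_or_eq_neg_at h' e2).resolve_right (sub_ne_zero.mp e1)⟩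

/-- Over a connected open set the square root is unique up to sign. -/
theorem eq_or_eq_neg [IsManifold 𝓘(ℂ) ω Y] (hr : IsProperDoubleCover r) (hf : Continuous f)
    (hfin : {z | f z = 0}.Finite) (hU : IsOpen U) (hUc : IsPreconnected U)
    (h : IsRootOn r f U y) (h' : IsRootOn r f U y') :
    (∀ x, r x ∈ U → y x = y' x) ∨ (∀ x, r x ∈ U → y x = -y' x) := by
  have key : ∀ y'' : Y → ℂ, IsRootOn r f U y'' →
      U \ {z | f z = 0} ⊆ r '' {x | (r x ∈ U ∧ f (r x) ≠ 0) ∧ y x = y'' x} →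
      ∀ x, r x ∈ U → y x = y'' x := by
    intro y'' h'' hsub x hx
    by_cases h0 : f (r x) = 0
    · rw [h.eq_zero hx h0, h''.eq_zero hx h0]
    · obtain ⟨x', ⟨⟨hx', -⟩, e⟩, hxx'⟩ := hsub ⟨hx, h0⟩
      exact h.eq_of_eq h'' hx' hxx'.symm e
  -- The loci `y = y'` and `y = -y'` have disjoint open images covering `U` minus the zeros of `f`,
  -- which is still connected. Arguing in the base avoids any connectedness of the cover.
  have ho := hr.isOpenMap _ (h.isOpen_setOf_eq h' hr.continuous hU hf)
  have ho' := hr.isOpenMap _ (h.isOpen_setOf_eq h'.neg hr.continuous hU hf)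
  have hdis : Disjoint (r '' {x | (r x ∈ U ∧ f (r x) ≠ 0) ∧ y x = y' x})
      (r '' {x | (r x ∈ U ∧ f (r x) ≠ 0) ∧ y x = -y' x}) := by
    rw [Set.disjoint_left]
    rintro _ ⟨x, ⟨⟨hx, h0⟩, e⟩, rfl⟩ ⟨x', ⟨⟨hx', h0'⟩, e'⟩, hxx'⟩
    have e1 := h.eq_of_eq h' hx hxx' e
    exact h'.ne_zero hx' h0' (self_eq_neg.mp (e1.symm.trans e'))
  have hcov : U \ {z | f z = 0} ⊆ r '' {x | (r x ∈ U ∧ f (r x) ≠ 0) ∧ y x = y' x} ∪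
      r '' {x | (r x ∈ U ∧ f (r x) ≠ 0) ∧ y x = -y' x} := by
    rintro z ⟨hz, h0⟩
    obtain ⟨x, rfl⟩ := hr.nonempty_fibre z
    rcases h.eq_or_eq_neg_at h' hz with e | e
    · exact Or.inl ⟨x, ⟨⟨hz, h0⟩, e⟩, rfl⟩
    · exact Or.inr ⟨x, ⟨⟨hz, h0⟩, e⟩, rfl⟩
  rcases (hUc.diff_finite_of_isOpen hU hfin).subset_or_subset ho ho' hdis hcov with hs | hs
  · exact Or.inl (key y' h' hs)
  · exact Or.inr (key _ h'.neg hs)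

theorem eqOn_of_eq_at [IsManifold 𝓘(ℂ) ω Y] (hr : IsProperDoubleCover r) (hf : Continuous f)
    (hfin : {z | f z = 0}.Finite) (hU : IsOpen U) (hUc : IsPreconnected U)
    (h : IsRootOn r f U y) (h' : IsRootOn r f U y') {x₀ : Y} (hx₀ : r x₀ ∈ U)
    (h0 : f (r x₀) ≠ 0) (e : y x₀ = y' x₀) : ∀ x, r x ∈ U → y x = y' x := by
  rcases h.eq_or_eq_neg hr hf hfin hU hUc h' with h1 | h1
  · exact h1
  · exact absurd (self_eq_neg.mp (e.symm.trans (h1 x₀ hx₀))) (h'.ne_zero hx₀ h0)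

theorem exists_ne_zero_mem [IsManifold 𝓘(ℂ) ω Y] (hr : IsProperDoubleCover r)
    (hfin : {z | f z = 0}.Finite) (hU : IsOpen U) (hne : U.Nonempty) :
    ∃ x, r x ∈ U ∧ f (r x) ≠ 0 := by
  obtain ⟨z, hz⟩ := hne
  have hinf : U.Infinite := infinite_of_mem_nhds z (hU.mem_nhds hz)
  obtain ⟨z', hz', h0⟩ := (hinf.sdiff hfin).nonempty
  obtain ⟨x, rfl⟩ := hr.nonempty_fibre z'
  exact ⟨x, hz', h0⟩

end IsRootOn

/-! ### Existence of a global square root. -/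

namespace IsProperDoubleCover

variable {Y : Type*} [TopologicalSpace Y] [ChartedSpace ℂ Y] [IsManifold 𝓘(ℂ) ω Y]
  {r : Y → ℂ} {f : ℂ → ℂ}

theorem exists_isRootOn_of_unbranched [T2Space Y] (hr : IsProperDoubleCover r) (hf : Differentiable ℂ f)
    {z₀ : ℂ} (hz : (r ⁻¹' {z₀}).ncard = 2) (h0 : f z₀ ≠ 0) :
    ∃ U, IsOpen U ∧ z₀ ∈ U ∧ ∃ y, IsRootOn r f U y := by
  classical
  obtain ⟨x₁, x₂, hne, rfl, h2⟩ := exists_ne_of_ncard_fibre_eq_two hz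
  obtain ⟨N₁, N₂, ho₁, ho₂, -, -, hd, W, hW, hzW, hcov, hinj₁, hinj₂⟩ := hr.exists_sheets hne h2
  obtain ⟨v, hv, hv0, hvf⟩ := (hf.analyticAt (r x₁)).exists_nthRoot h0 two_ne_zero
  obtain ⟨V, hV, hVo, hzV⟩ := mem_nhds_iff.mp (inter_mem (inter_mem hv.eventually_analyticAt
    hvf) (hv.continuousAt.eventually_ne hv0))
  -- Opposite signs of a local root of `f` on the two sheets make `y` separate the points of each
  -- fibre.
  let y : Y → ℂ := fun x => if x ∈ N₁ then v (r x) else -v (r x)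
  have hy1 : ∀ x ∈ N₁, y x = v (r x) := fun x hx => if_pos hx
  have hy2 : ∀ x ∈ N₂, y x = -v (r x) := fun x hx => if_neg (hd.notMem_of_mem_right hx)
  have hvm : ∀ x, r x ∈ V → MDifferentiableAt 𝓘(ℂ) 𝓘(ℂ) (fun x => v (r x)) x := fun x hx =>
    (hV hx).1.1.differentiableAt.comp_mdifferentiableAt (hr.mdifferentiable x)
  refine ⟨W ∩ V, hW.inter hVo, ⟨hzW, hzV⟩, y, ?_, ?_, ?_, ?_⟩
  · rintro x ⟨hxW, hxV⟩
    rcases hcov x hxW with hx | hx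
    · exact (hvm x hxV).congr_of_eventuallyEq (Filter.eventually_of_mem (ho₁.mem_nhds hx) hy1)
    · exact (hvm x hxV).neg.congr_of_eventuallyEq (Filter.eventually_of_mem (ho₂.mem_nhds hx) hy2)
  · rintro x ⟨hxW, hxV⟩
    have : v (r x) ^ 2 = f (r x) := (hV hxV).1.2
    rcases hcov x hxW with hx | hx
    · rw [hy1 x hx, this]
    · rw [hy2 x hx, neg_sq, this]
  · rintro x x' ⟨hxW, hxV⟩ hxx' e
    have hvx : v (r x) ≠ 0 := (hV hxV).2
    rcases hcov x hxW with hx | hx <;> rcases hcov x' (hxx' ▸ hxW) with hx' | hx'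
    · exact hinj₁ x x' hxW hxx' hx hx'
    · rw [hy1 x hx, hy2 x' hx', hxx'] at e
      exact absurd (self_eq_neg.mp e) hvx
    · rw [hy2 x hx, hy1 x' hx', hxx'] at e
      exact absurd (self_eq_neg.mp e.symm) hvx
    · exact hinj₂ x x' hxW hxx' hx hx'
  · rintro x ⟨hxW, hxV⟩ hfx
    have h1 : v (r x) ^ 2 = f (r x) := (hV hxV).1.2
    exact absurd (pow_eq_zero_iff two_ne_zero |>.mp (h1.trans hfx)) (hV hxV).2

/-- Near the branch point `r - b = ψ ^ 2`, and `f z = (z - b) * v z ^ 2` with `v b ≠ 0`, so `ψ *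
v(r)` is a root. Since `ψ` is a local coordinate, it separates fibres and has a simple zero. -/
theorem exists_isRootOn_of_branched [T2Space Y] (hr : IsProperDoubleCover r) (hf : Differentiable ℂ f)
    {b : ℂ} (hb : (r ⁻¹' {b}).ncard ≠ 2) (h0 : f b = 0) (hd : deriv f b ≠ 0) :
    ∃ U, IsOpen U ∧ b ∈ U ∧ ∃ y, IsRootOn r f U y := by
  obtain ⟨w, rfl⟩ := hr.nonempty_fibre b
  obtain ⟨N, hN, hwN, ψ, hψ, hψinj, hψ0, hψd, hψr⟩ := hr.exists_eq_sq hb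
  obtain ⟨W, hW, hbW, hWN⟩ := hr.exists_preimage_subset hN (z := r w) fun x hx =>
    (hr.eq_of_ncard_ne_two hx hb) ▸ hwN
  have hds : Differentiable ℂ (dslope f (r w)) := differentiableOn_univ.mp
    ((Complex.differentiableOn_dslope univ_mem).mpr hf.differentiableOn)
  obtain ⟨v, hv, hv0, hvf⟩ := (hds.analyticAt (r w)).exists_nthRoot (by rwa [dslope_same])
    two_ne_zero
  obtain ⟨V, hV, hVo, hbV⟩ := mem_nhds_iff.mp (inter_mem (inter_mem hv.eventually_analyticAt
    hvf) (hv.continuousAt.eventually_ne hv0))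
  have hvm : ∀ x, r x ∈ V → MDifferentiableAt 𝓘(ℂ) 𝓘(ℂ) (fun x => v (r x)) x := fun x hx =>
    (hV hx).1.1.differentiableAt.comp_mdifferentiableAt (hr.mdifferentiable x)
  have hsq : ∀ x, r x ∈ W ∩ V → (ψ x * v (r x)) ^ 2 = f (r x) := by
    rintro x ⟨hxW, hxV⟩
    have h1 : v (r x) ^ 2 = dslope f (r w) (r x) := (hV hxV).1.2
    have h2 := sub_smul_dslope f (r w) (r x)
    rw [h0, sub_zero, smul_eq_mul] at h2
    rw [mul_pow, h1, ← h2, hψr x (hWN hxW)]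
    ring
  refine ⟨W ∩ V, hW.inter hVo, ⟨hbW, hbV⟩, fun x => ψ x * v (r x), ?_, hsq, ?_, ?_⟩
  · rintro x ⟨hxW, hxV⟩
    exact (hψ x (hWN hxW)).mul (hvm x hxV)
  · rintro x x' ⟨hxW, hxV⟩ hxx' e
    rw [hxx'] at e
    exact hψinj (hWN hxW) (hWN (show r x' ∈ W from hxx' ▸ hxW)) (mul_right_cancel₀ (hV hxV).2 e)
  · rintro x ⟨hxW, hxV⟩ hfx
    have h1 := hsq x ⟨hxW, hxV⟩
    rw [hfx, pow_eq_zero_iff two_ne_zero, mul_eq_zero] at h1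
    have hx0 : ψ x = 0 := h1.resolve_right (hV hxV).2
    obtain rfl : x = w := hψinj (hWN hxW) hwN (hx0.trans hψ0.symm)
    rw [chartDeriv_mul (hψ x hwN) (hvm x hbV), hψ0, zero_mul, add_zero]
    exact mul_ne_zero hψd hv0

theorem exists_isRootOn_nhds [T2Space Y] (hr : IsProperDoubleCover r) (hf : Differentiable ℂ f)
    (hf0 : ∀ z, f z = 0 ↔ (r ⁻¹' {z}).ncard ≠ 2) (hfd : ∀ z, f z = 0 → deriv f z ≠ 0) (z : ℂ) :
    ∃ U, IsOpen U ∧ z ∈ U ∧ ∃ y, IsRootOn r f U y := by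
  by_cases h : f z = 0
  · exact hr.exists_isRootOn_of_branched hf ((hf0 z).mp h) h (hfd z h)
  · exact hr.exists_isRootOn_of_unbranched hf (not_not.mp fun h' => h ((hf0 z).mpr h')) h

/-- Continuation of the square root from a disc to a larger concentric disc. -/
theorem exists_isRootOn_ball_add (hr : IsProperDoubleCover r) (hf : Continuous f)
    (hfin : {z | f z = 0}.Finite) {ρ ε : ℝ} (hρ : 0 < ρ)
    (h0 : ∃ y, IsRootOn r f (Metric.ball 0 ρ) y)
    (hc : ∀ c ∈ Metric.sphere (0 : ℂ) ρ, ∃ y, IsRootOn r f (Metric.ball c ε) y) :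
    ∃ y, IsRootOn r f (Metric.ball 0 (ρ + ε)) y := by
  classical
  obtain ⟨y₀, hy₀⟩ := h0
  have hc' : ∀ c : ℂ, ∃ y, c ∈ Metric.sphere (0 : ℂ) ρ → IsRootOn r f (Metric.ball c ε) y ∧
      ∀ x, r x ∈ Metric.ball c ε ∩ Metric.ball 0 ρ → y x = y₀ x := by
    intro c
    by_cases hcs : c ∈ Metric.sphere (0 : ℂ) ρ
    · obtain ⟨y, hy⟩ := hc c hcs
      rcases (hy.mono inter_subset_left).eq_or_eq_neg hr hf hfin
        (Metric.isOpen_ball.inter Metric.isOpen_ball)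
        ((convex_ball c ε).inter (convex_ball 0 ρ)).isPreconnected (hy₀.mono inter_subset_right)
        with h | h
      · exact ⟨y, fun _ => ⟨hy, h⟩⟩
      · exact ⟨fun x => -y x, fun _ => ⟨hy.neg, fun x hx => neg_eq_iff_eq_neg.mpr (h x hx)⟩⟩
    · exact ⟨y₀, fun h => absurd h hcs⟩
  choose Y' hY' using hc'
  -- Radial projection to the sphere picks a boundary disc containing each point of the outer
  -- annulus.
  let p : ℂ → ℂ := fun z => ((ρ / ‖z‖ : ℝ) : ℂ) * z
  have hp : ∀ z, z ≠ 0 → p z ∈ Metric.sphere (0 : ℂ) ρ := by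
    intro z hz
    have hz' := norm_pos_iff.mpr hz
    rw [mem_sphere_zero_iff_norm, norm_mul, Complex.norm_real,
      Real.norm_of_nonneg (by positivity), div_mul_cancel₀ _ hz'.ne']
  have hpd : ∀ z, ρ ≤ ‖z‖ → ‖z‖ < ρ + ε → z ∈ Metric.ball (p z) ε := by
    intro z h1 h2
    have hz' : 0 < ‖z‖ := hρ.trans_le h1
    have : z - p z = ((1 - ρ / ‖z‖ : ℝ) : ℂ) * z := by simp only [p]; push_cast; ring
    rw [mem_ball_iff_norm, this, norm_mul, Complex.norm_real, Real.norm_of_nonneg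
      (sub_nonneg.mpr ((div_le_one hz').mpr h1)), sub_mul, div_mul_cancel₀ _ hz'.ne']
    linarith
  let y : Y → ℂ := fun x => if ‖r x‖ < ρ then y₀ x else Y' (p (r x)) x
  have hy1 : ∀ x, r x ∈ Metric.ball (0 : ℂ) ρ → y x = y₀ x := fun x hx =>
    if_pos (mem_ball_zero_iff.mp hx)
  have hy2 : ∀ c ∈ Metric.sphere (0 : ℂ) ρ, ∀ x,
      r x ∈ Metric.ball c ε ∩ Metric.ball 0 (ρ + ε) → y x = Y' c x := by
    rintro c hcs x ⟨hxc, hxρ⟩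
    by_cases hx : ‖r x‖ < ρ
    · rw [hy1 x (mem_ball_zero_iff.mpr hx)]
      exact ((hY' c hcs).2 x ⟨hxc, mem_ball_zero_iff.mpr hx⟩).symm
    · have hxρ' : ρ ≤ ‖r x‖ := not_lt.mp hx
      have hr0 : r x ≠ 0 := norm_pos_iff.mp (hρ.trans_le hxρ')
      have hps := hp _ hr0
      have hpx := hpd _ hxρ' (mem_ball_zero_iff.mp hxρ)
      set c' := p (r x) with hc'
      have e : y x = Y' c' x := if_neg hx
      rw [e]
      -- Two boundary discs that meet contain the midpoint of their centres, which lies in the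
      -- closed large disc. So their intersection meets the open large disc, where both roots equal
      -- `y₀`; uniqueness spreads this agreement.
      have hm : midpoint ℝ c c' ∈ Metric.ball c ε ∩ Metric.ball c' ε := by
        have hcc : dist c c' < 2 * ε := by
          have h1 := Metric.mem_ball.mp hxc
          have h2 := Metric.mem_ball.mp hpx
          have := dist_triangle_left c c' (r x)
          linarith
        constructor <;> rw [Metric.mem_ball]
        · rw [dist_midpoint_left, Real.norm_of_nonneg two_pos.le]; linarith
        · rw [dist_midpoint_right, Real.norm_of_nonneg two_pos.le]; linarith
      have hmc : midpoint ℝ c c' ∈ closure (Metric.ball (0 : ℂ) ρ) := by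
        rw [closure_ball _ hρ.ne']
        exact (convex_closedBall (0 : ℂ) ρ).midpoint_mem (Metric.sphere_subset_closedBall hcs)
          (Metric.sphere_subset_closedBall hps)
      have hopen : IsOpen (Metric.ball c ε ∩ Metric.ball c' ε) :=
        Metric.isOpen_ball.inter Metric.isOpen_ball
      obtain ⟨x₀, ⟨hx₀, hx₀ρ⟩, hfx₀⟩ := IsRootOn.exists_ne_zero_mem hr hfin
        (hopen.inter Metric.isOpen_ball) (mem_closure_iff.mp hmc _ hopen hm)
      refine IsRootOn.eqOn_of_eq_at hr hf hfin hopen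
        ((convex_ball c ε).inter (convex_ball c' ε)).isPreconnected
        ((hY' c' hps).1.mono inter_subset_right) ((hY' c hcs).1.mono inter_subset_left)
        hx₀ hfx₀ ?_ x ⟨hxc, hpx⟩
      rw [(hY' c' hps).2 x₀ ⟨hx₀.2, hx₀ρ⟩, (hY' c hcs).2 x₀ ⟨hx₀.1, hx₀ρ⟩]
  refine ⟨y, IsRootOn.of_local hr.continuous fun z hz => ?_⟩
  by_cases hzρ : ‖z‖ < ρ
  · exact ⟨_, Metric.isOpen_ball, mem_ball_zero_iff.mpr hzρ, y₀, hy₀, hy1⟩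
  · have hzρ' : ρ ≤ ‖z‖ := not_lt.mp hzρ
    have hps := hp _ (norm_pos_iff.mp (hρ.trans_le hzρ'))
    exact ⟨_, Metric.isOpen_ball.inter Metric.isOpen_ball,
      ⟨hpd _ hzρ' (mem_ball_zero_iff.mp hz), hz⟩, _, (hY' _ hps).1.mono inter_subset_left,
      hy2 _ hps⟩

theorem exists_isRootOn_ball [T2Space Y] (hr : IsProperDoubleCover r) (hf : Differentiable ℂ f)
    (hf0 : ∀ z, f z = 0 ↔ (r ⁻¹' {z}).ncard ≠ 2) (hfd : ∀ z, f z = 0 → deriv f z ≠ 0) (ρ : ℝ) :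
    ∃ y, IsRootOn r f (Metric.ball 0 ρ) y := by
  have hfin : {z | f z = 0}.Finite := by
    have : {z | f z = 0} = {z | (r ⁻¹' {z}).ncard ≠ 2} := Set.ext hf0
    rw [this]; exact hr.finite_branch
  choose U hU hzU hy using hr.exists_isRootOn_nhds hf hf0 hfd
  obtain ⟨ε, hε, hleb⟩ := lebesgue_number_lemma_of_metric (isCompact_closedBall (0 : ℂ) |ρ|) hU
    fun z _ => mem_iUnion.mpr ⟨z, hzU z⟩
  have hloc : ∀ c ∈ Metric.closedBall (0 : ℂ) |ρ|, ∃ y, IsRootOn r f (Metric.ball c ε) y := by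
    intro c hc
    obtain ⟨z, hz⟩ := hleb c hc
    obtain ⟨y, hy⟩ := hy z
    exact ⟨y, hy.mono hz⟩
  -- The radius grows by the Lebesgue number `ε`. The condition `k * ε ≤ |ρ|` keeps the sphere of
  -- radius `k * ε`, where the last extension starts, inside the compact disc.
  have hind : ∀ k : ℕ, k * ε ≤ |ρ| → ∃ y, IsRootOn r f (Metric.ball 0 ((k + 1 : ℕ) * ε)) y := by
    intro k
    induction k with
    | zero =>
      intro _
      simpa using hloc 0 (Metric.mem_closedBall_self (abs_nonneg ρ))
    | succ k ih =>
      intro hk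
      have hk' : (k : ℝ) * ε ≤ |ρ| := by
        refine le_trans ?_ hk
        gcongr
        simp
      have hsum : ((k + 1 + 1 : ℕ) : ℝ) * ε = ((k + 1 : ℕ) : ℝ) * ε + ε := by push_cast; ring
      rw [hsum]
      refine hr.exists_isRootOn_ball_add hf.continuous hfin (by positivity) (ih hk') fun c hc =>
        hloc c ?_
      rw [mem_closedBall_zero_iff, mem_sphere_zero_iff_norm.mp hc]
      exact hk
  obtain ⟨y, hy⟩ := hind ⌊|ρ| / ε⌋₊ (by
    rw [← le_div_iff₀ hε]
    exact Nat.floor_le (by positivity))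
  refine ⟨y, hy.mono (Metric.ball_subset_ball ?_)⟩
  have h1 := Nat.lt_floor_add_one (|ρ| / ε)
  rw [div_lt_iff₀ hε] at h1
  push_cast
  exact (le_abs_self ρ).trans h1.le

/-- A proper double cover of the plane is the Riemann surface of a square root: there is a global
holomorphic square root of `f ∘ r` separating the points of the fibres. -/
theorem exists_isRootOn_univ [T2Space Y] (hr : IsProperDoubleCover r) (hf : Differentiable ℂ f)
    (hf0 : ∀ z, f z = 0 ↔ (r ⁻¹' {z}).ncard ≠ 2) (hfd : ∀ z, f z = 0 → deriv f z ≠ 0) :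
    ∃ y, IsRootOn r f univ y := by
  have hfin : {z | f z = 0}.Finite := by
    have : {z | f z = 0} = {z | (r ⁻¹' {z}).ncard ≠ 2} := Set.ext hf0
    rw [this]; exact hr.finite_branch
  -- Prescribing a nonzero value at one point fixes the sign over every disc, so the roots over the
  -- exhausting discs agree.
  obtain ⟨x₀, -, hx₀⟩ := IsRootOn.exists_ne_zero_mem hr hfin isOpen_univ univ_nonempty
  obtain ⟨s, hs⟩ := IsAlgClosed.exists_pow_nat_eq (f (r x₀)) two_pos
  have hn : ∀ n : ℕ, ∃ y, IsRootOn r f (Metric.ball 0 (‖r x₀‖ + 1 + n)) y ∧ y x₀ = s := by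
    intro n
    obtain ⟨y, hy⟩ := hr.exists_isRootOn_ball hf hf0 hfd (‖r x₀‖ + 1 + n)
    have hx : r x₀ ∈ Metric.ball (0 : ℂ) (‖r x₀‖ + 1 + n) := by
      rw [mem_ball_zero_iff]
      have : (0 : ℝ) ≤ n := n.cast_nonneg
      linarith
    rcases sq_eq_sq_iff_eq_or_eq_neg.mp ((hy.sq x₀ hx).trans hs.symm) with h | h
    · exact ⟨y, hy, h⟩
    · exact ⟨fun x => -y x, hy.neg, neg_eq_iff_eq_neg.mpr h⟩
  choose y hy hys using hn
  have hagree : ∀ n m : ℕ, n ≤ m → ∀ x, r x ∈ Metric.ball (0 : ℂ) (‖r x₀‖ + 1 + n) →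
      y m x = y n x := by
    intro n m hnm
    have hsub : Metric.ball (0 : ℂ) (‖r x₀‖ + 1 + n) ⊆ Metric.ball 0 (‖r x₀‖ + 1 + m) := by
      apply Metric.ball_subset_ball
      gcongr
    have hx : r x₀ ∈ Metric.ball (0 : ℂ) (‖r x₀‖ + 1 + n) := by
      rw [mem_ball_zero_iff]
      have : (0 : ℝ) ≤ n := n.cast_nonneg
      linarith
    exact IsRootOn.eqOn_of_eq_at hr hf.continuous hfin Metric.isOpen_ball
      (convex_ball _ _).isPreconnected ((hy m).mono hsub) (hy n) hx hx₀ ((hys m).trans (hys n).symm)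
  have hmem : ∀ z : ℂ, z ∈ Metric.ball (0 : ℂ) (‖r x₀‖ + 1 + ⌈‖z‖⌉₊) := by
    intro z
    rw [mem_ball_zero_iff]
    have h1 := Nat.le_ceil ‖z‖
    have h2 := norm_nonneg (r x₀)
    linarith
  refine ⟨fun x => y ⌈‖r x‖⌉₊ x, IsRootOn.of_local hr.continuous fun z _ =>
    ⟨_, Metric.isOpen_ball, hmem z, _, hy ⌈‖z‖⌉₊, fun x hx => ?_⟩⟩
  rcases le_total ⌈‖z‖⌉₊ ⌈‖r x‖⌉₊ with h | h
  · exact hagree _ _ h x hx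
  · exact (hagree _ _ h x (hmem (r x))).symm

end IsProperDoubleCover

/-! ### Meromorphic functions with prescribed poles. -/

section Quotient

variable {Y : Type*} [TopologicalSpace Y] [ChartedSpace ℂ Y] [IsManifold 𝓘(ℂ) ω Y]

theorem AnalyticAt.differentiableAt_dslope {U : ℂ → ℂ} {t₀ : ℂ} (hU : AnalyticAt ℂ U t₀) :
    DifferentiableAt ℂ (dslope U t₀) t₀ := by
  obtain ⟨S, hS, hd⟩ := hU.eventually_analyticAt.exists_mem
  have : DifferentiableOn ℂ U S := fun t ht => (hd t ht).differentiableAt.differentiableWithinAt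
  exact ((Complex.differentiableOn_dslope hS).mpr this).differentiableAt hS

/-- A quotient `u / v` extends holomorphically over a common zero of `u` and `v` which is simple
for `v`. -/
theorem mdifferentiableAt_of_eq_div {u v h : Y → ℂ} {x : Y}
    (hu : MDifferentiable 𝓘(ℂ) 𝓘(ℂ) u) (hv : MDifferentiable 𝓘(ℂ) 𝓘(ℂ) v) (hux : u x = 0)
    (hvx : v x = 0) (hvd : chartDeriv v x ≠ 0) (hh : ∀ x', v x' ≠ 0 → h x' = u x' / v x')
    (hhx : h x = chartDeriv u x / chartDeriv v x) : MDifferentiableAt 𝓘(ℂ) 𝓘(ℂ) h x := by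
  set e := chartAt ℂ x with he
  set U := u ∘ e.symm with hU
  set V := v ∘ e.symm with hV
  have hex : e.symm (e x) = x := e.left_inv (mem_chart_source ℂ x)
  have hUa : AnalyticAt ℂ U (e x) := analyticAt_comp_chart_symm (.of_forall hu)
  have hVa : AnalyticAt ℂ V (e x) := analyticAt_comp_chart_symm (.of_forall hv)
  have hU0 : U (e x) = 0 := by rw [hU, Function.comp_apply, hex, hux]
  have hV0 : V (e x) = 0 := by rw [hV, Function.comp_apply, hex, hvx]
  have hQ : DifferentiableAt ℂ (fun t => dslope U (e x) t / dslope V (e x) t) (e x) :=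
    hUa.differentiableAt_dslope.div hVa.differentiableAt_dslope (by rw [dslope_same]; exact hvd)
  refine (mdifferentiableAt_comp_chartAt (mem_chart_source ℂ x) hQ).congr_of_eventuallyEq ?_
  have hne : ∀ᶠ t in 𝓝 (e x), t ≠ e x → V t ≠ 0 := by
    have h1 := hVa.differentiableAt.hasDerivAt.eventually_ne (c := 0) hvd
    exact eventually_nhdsWithin_iff.mp h1
  filter_upwards [(e.continuousAt (mem_chart_source ℂ x)).eventually hne,
    e.open_source.mem_nhds (mem_chart_source ℂ x)] with x' h1 h2
  rcases eq_or_ne x' x with rfl | hxx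
  · rw [dslope_same, dslope_same, hhx]; rfl
  · have hte : e x' ≠ e x := fun h => hxx (e.injOn h2 (mem_chart_source ℂ x) h)
    have hVt : V (e x') = v x' := by rw [hV, Function.comp_apply, e.left_inv h2]
    have hUt : U (e x') = u x' := by rw [hU, Function.comp_apply, e.left_inv h2]
    have hvx' : v x' ≠ 0 := hVt ▸ h1 hte
    rw [hh x' hvx', dslope_of_ne _ hte, dslope_of_ne _ hte, slope_def_field, slope_def_field,
      hU0, hV0, sub_zero, sub_zero, hUt, hVt, div_div_div_cancel_right₀ (sub_ne_zero.mpr hte)]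

end Quotient

theorem finite_image_inter_closedBall {Y : Type*} {r : Y → ℂ} {D : Set Y}
    (hD : ∀ M : ℝ, (D ∩ r ⁻¹' Metric.closedBall 0 M).Finite) (M : ℝ) :
    (r '' D ∩ Metric.closedBall 0 M).Finite := by
  refine ((hD M).image r).subset ?_
  rintro _ ⟨⟨x, hx, rfl⟩, hM⟩
  exact ⟨x, ⟨hx, hM⟩, rfl⟩

namespace IsProperDoubleCover

variable {Y : Type*} [TopologicalSpace Y] [ChartedSpace ℂ Y] {r : Y → ℂ} {D : Set Y}

/-- Near any point of the surface, no other point lies over a given locally finite set. -/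
theorem eventually_notMem_of_ne [T2Space Y] (hr : IsProperDoubleCover r) {E : Set ℂ}
    (hE : ∀ M : ℝ, (E ∩ Metric.closedBall 0 M).Finite) (x : Y) :
    ∀ᶠ x' in 𝓝 x, x' ≠ x → r x' ∉ E := by
  have hfin : (r ⁻¹' (E ∩ Metric.closedBall 0 (‖r x‖ + 1))).Finite :=
    (hE _).preimage' fun z _ => hr.finite_fibre z
  have h1 : (r ⁻¹' (E ∩ Metric.closedBall 0 (‖r x‖ + 1)) \ {x})ᶜ ∈ 𝓝 x :=
    (hfin.subset sdiff_subset).isClosed.isOpen_compl.mem_nhds (by simp)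
  have h2 : r ⁻¹' Metric.ball 0 (‖r x‖ + 1) ∈ 𝓝 x :=
    (Metric.isOpen_ball.preimage hr.continuous).mem_nhds (by simp)
  filter_upwards [h1, h2] with x' h1 h2 hne hE'
  exact h1 ⟨⟨hE', Metric.ball_subset_closedBall h2⟩, hne⟩

/-- On a proper double cover of the plane, there is a meromorphic function with poles exactly at a
given locally finite set `D`, which together with the covering map gives an injective immersion off
`D`. -/
theorem exists_function_with_poles [IsManifold 𝓘(ℂ) ω Y] [T2Space Y] (hr : IsProperDoubleCover r)
    (hD : ∀ M : ℝ, (D ∩ r ⁻¹' Metric.closedBall 0 M).Finite) :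
    ∃ h : Y → ℂ, (∀ x ∉ D, MDifferentiableAt 𝓘(ℂ) 𝓘(ℂ) h x) ∧
      (∀ x ∉ D, chartDeriv r x ≠ 0 ∨ chartDeriv h x ≠ 0) ∧
      (∀ x ∉ D, ∀ x' ∉ D, r x = r x' → h x = h x' → x = x') ∧
      ∀ x ∈ D, ∀ M : ℝ, ∀ᶠ x' in 𝓝 x, x' ∉ D → M < ‖h x'‖ := by
  classical
  have hE := finite_image_inter_closedBall hD
  obtain ⟨f, hf, hf0, hfd⟩ := exists_entire_simple_zeros
    (E := {z : ℂ | (r ⁻¹' {z}).ncard ≠ 2}) fun M => hr.finite_branch.subset inter_subset_left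
  obtain ⟨y, hy⟩ := hr.exists_isRootOn_univ hf hf0 fun z hz => hfd z ((hf0 z).mp hz)
  obtain ⟨g, hg, hg0, hgd⟩ := exists_entire_simple_zeros hE
  -- If the fibre has a point `x` outside `D`, then `-y x` kills it and not its partner, since `y`
  -- separates them. Otherwise any value avoiding finitely many works.
  have hval : ∀ z : ℂ, ∃ α : ℂ, z ∈ r '' D → (∀ x ∈ D, r x = z → α + y x ≠ 0) ∧
      ∀ x ∉ D, r x = z → α + y x = 0 := by
    intro z
    by_cases hx : ∃ x ∉ D, r x = z
    · obtain ⟨x, hxD, rfl⟩ := hx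
      refine ⟨-y x, fun ⟨d, hdD, hd⟩ => ⟨fun x' hx' hxx' e => ?_, fun x' hx' hxx' => ?_⟩⟩
      · have : x = x' := hy.inj x x' (mem_univ _) hxx' (neg_add_eq_zero.mp e)
        exact hxD (this ▸ hx')
      · have hdx : x ≠ d := fun h => hxD (h ▸ hdD)
        rcases hr.eq_of_three hd hxx' hdx with h | h
        · rw [h, neg_add_cancel]
        · exact absurd hdD (h ▸ hx')
    · obtain ⟨α, hα⟩ := ((hr.finite_fibre z).image fun x => -y x).exists_notMem
      refine ⟨α, fun _ => ⟨fun x _ hxz e => hα ⟨x, hxz, (eq_neg_of_add_eq_zero_left e).symm⟩,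
        fun x hxD hxz => absurd ⟨x, hxD, hxz⟩ hx⟩⟩
  choose c hc using hval
  obtain ⟨a, ha, hac⟩ := exists_entire_interpolation hE c
  let u : Y → ℂ := fun x => a (r x) + y x
  let v : Y → ℂ := fun x => g (r x)
  have hym : MDifferentiable 𝓘(ℂ) 𝓘(ℂ) y := fun x => hy.mdifferentiableAt x (mem_univ _)
  have ham : MDifferentiable 𝓘(ℂ) 𝓘(ℂ) fun x => a (r x) := fun x =>
    (ha (r x)).comp_mdifferentiableAt (hr.mdifferentiable x)
  have hu : MDifferentiable 𝓘(ℂ) 𝓘(ℂ) u := fun x => (ham x).add (hym x)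
  have hv : MDifferentiable 𝓘(ℂ) 𝓘(ℂ) v := fun x =>
    (hg (r x)).comp_mdifferentiableAt (hr.mdifferentiable x)
  have huD : ∀ x ∈ D, u x ≠ 0 := by
    intro x hx
    have hxE : r x ∈ r '' D := mem_image_of_mem r hx
    simp only [u, hac _ hxE]
    exact (hc _ hxE).1 x hx rfl
  have hu0 : ∀ x ∉ D, v x = 0 → u x = 0 := by
    intro x hx hvx
    have hxE : r x ∈ r '' D := (hg0 _).mp hvx
    simp only [u, hac _ hxE]
    exact (hc _ hxE).2 x hx rfl
  have hrd : ∀ x ∉ D, v x = 0 → chartDeriv r x ≠ 0 := by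
    intro x hx hvx
    obtain ⟨d, hd, hdx⟩ := (hg0 _).mp hvx
    exact hr.chartDeriv_ne_zero (fun h => hx (h ▸ hd)) hdx
  have hcv : ∀ x, chartDeriv v x = deriv g (r x) * chartDeriv r x := fun x =>
    chartDeriv_comp (hr.mdifferentiable x) (hg _)
  have hcu : ∀ x, chartDeriv u x = deriv a (r x) * chartDeriv r x + chartDeriv y x := fun x => by
    rw [← chartDeriv_comp (hr.mdifferentiable x) (ha _)]
    exact chartDeriv_add (ham x) (hym x)
  -- At removable singularities the value is the l'Hôpital quotient; at points of `D` it is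
  -- immaterial.
  let h : Y → ℂ := fun x => if v x = 0 then chartDeriv u x / chartDeriv v x else u x / v x
  have hh : ∀ x, v x ≠ 0 → h x = u x / v x := fun x hx => if_neg hx
  have hhm : ∀ x ∉ D, MDifferentiableAt 𝓘(ℂ) 𝓘(ℂ) h x := by
    intro x hx
    by_cases hvx : v x = 0
    · refine mdifferentiableAt_of_eq_div hu hv (hu0 x hx hvx) hvx ?_ hh (if_pos hvx)
      rw [hcv]
      exact mul_ne_zero (hgd _ ((hg0 _).mp hvx)) (hrd x hx hvx)
    · refine ((hu x).div (hv x) hvx).congr_of_eventuallyEq ?_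
      filter_upwards [(hv x).continuousAt.eventually_ne hvx] with x' hx'
      exact hh x' hx'
  refine ⟨h, hhm, fun x hx => ?_, fun x hx x' hx' hrx e => ?_, fun x hx M => ?_⟩
  -- Where `r' = 0` the fibre is branched and `v ≠ 0`. Differentiating `u = h * v` with `h' = 0`
  -- then gives `y' = 0`, contrary to the simple zero of `y`.
  · by_contra! hcon
    obtain ⟨hcr, hch⟩ := hcon
    have hvx : v x ≠ 0 := fun hvx => hrd x hx hvx hcr
    have hfx : f (r x) = 0 := (hf0 _).mpr fun h2 => hr.chartDeriv_ne_zero_of_ncard h2 hcr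
    have huv : u =ᶠ[𝓝 x] fun x' => h x' * v x' := by
      filter_upwards [(hv x).continuousAt.eventually_ne hvx] with x' hx'
      rw [hh x' hx', div_mul_cancel₀ _ hx']
    have h1 := chartDeriv_congr huv
    rw [chartDeriv_mul (hhm x hx) (hv x), hch, hcv, hcu, hcr] at h1
    simp only [mul_zero, zero_add, zero_mul, add_zero] at h1
    exact hy.chartDeriv_ne_zero x (mem_univ _) hfx h1
  · by_cases hvx : v x = 0
    · obtain ⟨d, hd, hdx⟩ := (hg0 _).mp hvx
      by_contra hne
      rcases hr.eq_of_three hrx.symm hdx hne with h' | h'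
      · exact hx (h' ▸ hd)
      · exact hx' (h' ▸ hd)
    · have hvx' : v x' = v x := congrArg g hrx.symm
      rw [hh x hvx, hh x' (hvx'.symm ▸ hvx), hvx', div_left_inj' hvx] at e
      simp only [u, hrx, add_right_inj] at e
      exact hy.inj x x' (mem_univ _) hrx.symm e
  · have hux : 0 < ‖u x‖ := norm_pos_iff.mpr (huD x hx)
    have hvx : v x = 0 := (hg0 _).mpr (mem_image_of_mem r hx)
    have e1 : ∀ᶠ x' in 𝓝 x, ‖u x‖ / 2 < ‖u x'‖ :=
      (hu x).continuousAt.norm.eventually_const_lt (half_lt_self hux)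
    have e2 : ∀ᶠ x' in 𝓝 x, |M| * ‖v x'‖ < ‖u x‖ / 2 := by
      refine ((hv x).continuousAt.norm.const_mul |M|).eventually_lt_const ?_
      simpa [hvx] using hux
    filter_upwards [e1, e2, hr.eventually_notMem_of_ne hE x] with x' h1 h2 h3 hx'D
    have hvx' : v x' ≠ 0 := fun h0 => h3 (fun h => hx'D (h ▸ hx)) ((hg0 _).mp h0)
    rw [hh x' hvx', norm_div, lt_div_iff₀ (norm_pos_iff.mpr hvx')]
    exact (mul_le_mul_of_nonneg_right (le_abs_self M) (norm_nonneg _)).trans_lt (h2.trans h1)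

end IsProperDoubleCover

/-! ### Immersions into the plane `ℂ²` and restriction to open subsets. -/

/-- A pair of holomorphic functions is immersive where one of them has nonzero derivative. -/
theorem mfderiv_prodMk_injective {M : Type*} [TopologicalSpace M] [ChartedSpace ℂ M]
    {g₁ g₂ : M → ℂ} {x : M} (h₁ : MDifferentiableAt 𝓘(ℂ) 𝓘(ℂ) g₁ x)
    (h₂ : MDifferentiableAt 𝓘(ℂ) 𝓘(ℂ) g₂ x) (hne : chartDeriv g₁ x ≠ 0 ∨ chartDeriv g₂ x ≠ 0) :
    Function.Injective (mfderiv 𝓘(ℂ) 𝓘(ℂ, ℂ × ℂ) (fun x => (g₁ x, g₂ x)) x) := by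
  have hΦ : MDifferentiableAt 𝓘(ℂ) 𝓘(ℂ, ℂ × ℂ) (fun x => (g₁ x, g₂ x)) x := h₁.prodMk_space h₂
  have d₁ := h₁.differentiableAt_comp_chart
  have d₂ := h₂.differentiableAt_comp_chart
  have hfd := d₁.fderiv_prodMk d₂
  have heq : mfderiv 𝓘(ℂ) 𝓘(ℂ, ℂ × ℂ) (fun x => (g₁ x, g₂ x)) x =
      (fderiv ℂ (g₁ ∘ (chartAt ℂ x).symm) (chartAt ℂ x x)).prod
        (fderiv ℂ (g₂ ∘ (chartAt ℂ x).symm) (chartAt ℂ x x)) := by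
    rw [← hfd, hΦ.mfderiv]
    simp only [writtenInExtChartAt, extChartAt_model_space_eq_id, modelWithCornersSelf_coe, range_id,
      fderivWithin_univ]
    rfl
  rw [heq]
  refine (injective_iff_map_eq_zero _).mpr fun (w : ℂ) hw => ?_
  have e₁ : fderiv ℂ (g₁ ∘ (chartAt ℂ x).symm) (chartAt ℂ x x) w = 0 := congrArg Prod.fst hw
  have e₂ : fderiv ℂ (g₂ ∘ (chartAt ℂ x).symm) (chartAt ℂ x x) w = 0 := congrArg Prod.snd hw
  rw [fderiv_eq_smul_deriv, smul_eq_mul, mul_eq_zero] at e₁ e₂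
  rcases hne with h | h
  · exact e₁.resolve_right h
  · exact e₂.resolve_right h

theorem chartDeriv_comp_inclusion {X : Type*} [TopologicalSpace X] [ChartedSpace ℂ X]
    {U V : TopologicalSpace.Opens X} (hUV : U ≤ V) (g : V → ℂ) (x : U) :
    chartDeriv (g ∘ TopologicalSpace.Opens.inclusion hUV) x =
      chartDeriv g (TopologicalSpace.Opens.inclusion hUV x) := by
  have h := TopologicalSpace.Opens.chartAt_inclusion_symm_eventuallyEq (H := ℂ) hUV (x := x)
  have h' : (g ∘ TopologicalSpace.Opens.inclusion hUV) ∘ (chartAt ℂ x).symm =ᶠ[𝓝 (chartAt ℂ x x)]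
      g ∘ (chartAt ℂ (TopologicalSpace.Opens.inclusion hUV x)).symm :=
    Filter.EventuallyEq.symm (h.fun_comp g)
  exact h'.deriv_eq

/-! ### Moving a point of the sphere to infinity. -/

section AffineCoordinate

variable {X : Type*} [TopologicalSpace X] [ChartedSpace ℂ X] {R : X → OnePoint ℂ}

/-- After a Möbius transformation moving `p` to infinity, a map to the sphere becomes a function
off the fibre over `p`. -/
theorem IsHolomorphicToSphere.exists_affine_coordinate (hR : IsHolomorphicToSphere R)
    (p : OnePoint ℂ) : ∃ (r : X → ℂ) (e : ℂ → OnePoint ℂ), Function.Injective e ∧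
      (∀ z, e z ≠ p) ∧ (∀ x, R x ≠ p → e (r x) = R x) ∧
      (∀ x, R x ≠ p → MDifferentiableAt 𝓘(ℂ) 𝓘(ℂ) r x) ∧
      ∀ M : ℝ, 0 ≤ M → IsClosed (e '' Metric.closedBall 0 M) := by
  classical
  induction p using OnePoint.rec with
  | infty =>
    refine ⟨fun x => sphereCoord (R x), (↑), OnePoint.coe_injective, fun z => OnePoint.coe_ne_infty z,
      fun x hx => ?_, hR.mdifferentiableAt_of_ne_infty, fun M _ =>
        OnePoint.isClosed_image_coe.mpr ⟨Metric.isClosed_closedBall, isCompact_closedBall 0 M⟩⟩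
    obtain ⟨z, hz⟩ := OnePoint.ne_infty_iff_exists.mp hx
    change ((sphereCoord (R x) : ℂ) : OnePoint ℂ) = R x
    rw [← hz]; rfl
  | coe a =>
    -- This inverts `w ↦ 1 / (w - a)`. The value `r = 0` over infinity is the true one, while over
    -- `a` it is a default.
    let e : ℂ → OnePoint ℂ := fun z => if z = 0 then OnePoint.infty else ((a + z⁻¹ : ℂ) : OnePoint ℂ)
    let r : X → ℂ := fun x => (R x).elim 0 fun z => (z - a)⁻¹
    have hr : ∀ x (z : ℂ), R x = z → r x = (z - a)⁻¹ := fun x z h => by simp only [r, h]; rfl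
    have hr' : ∀ x, R x = OnePoint.infty → r x = 0 := fun x h => by simp only [r, h]; rfl
    have he0 : e 0 = OnePoint.infty := if_pos rfl
    have he : ∀ z, z ≠ 0 → e z = ((a + z⁻¹ : ℂ) : OnePoint ℂ) := fun z hz => if_neg hz
    refine ⟨r, e, fun z w h => ?_, fun z h => ?_, fun x hx => ?_, fun x hx => ?_, fun M hM => ?_⟩
    · by_cases hz : z = 0 <;> by_cases hw : w = 0
      · rw [hz, hw]
      · rw [hz, he0, he w hw] at h; exact absurd h (OnePoint.infty_ne_coe _)
      · rw [hw, he0, he z hz] at h; exact absurd h (OnePoint.coe_ne_infty _)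
      · rw [he z hz, he w hw, OnePoint.coe_eq_coe, add_right_inj] at h
        exact inv_injective h
    · by_cases hz : z = 0
      · rw [hz, he0] at h; exact OnePoint.infty_ne_coe _ h
      · rw [he z hz, OnePoint.coe_eq_coe, add_eq_left, inv_eq_zero] at h
        exact hz h
    · by_cases hxi : R x = OnePoint.infty
      · rw [hr' x hxi, he0, hxi]
      · obtain ⟨z, hz⟩ := OnePoint.ne_infty_iff_exists.mp hxi
        have hza : z - a ≠ 0 := fun h => hx (by rw [← hz, sub_eq_zero.mp h])
        rw [hr x z hz.symm, he _ (inv_ne_zero hza), inv_inv, add_sub_cancel, hz]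
    · by_cases hxi : R x = OnePoint.infty
      · have hs := hR.mdifferentiableAt_of_eq_infty x hxi
        have hs0 : sphereCoordInfty (R x) = 0 := by rw [hxi]; rfl
        -- With `s = 1 / w` near infinity, `1 / (w - a) = s / (1 - a * s)`.
        have hq : DifferentiableAt ℂ (fun s : ℂ => s / (1 - a * s)) (sphereCoordInfty (R x)) := by
          refine differentiableAt_id.div ((differentiableAt_const 1).sub
            (differentiableAt_id.const_mul a)) ?_
          simp [hs0]
        refine (hq.comp_mdifferentiableAt (f := fun x' => sphereCoordInfty (R x'))
          hs).congr_of_eventuallyEq ?_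
        have hne : ∀ᶠ x' in 𝓝 x, R x' ≠ ((0 : ℂ) : OnePoint ℂ) :=
          hR.continuous.continuousAt.eventually_ne (by rw [hxi]; exact OnePoint.infty_ne_coe _)
        filter_upwards [hne] with x' hx'
        by_cases hi : R x' = OnePoint.infty
        · rw [hr' x' hi, Function.comp_apply, hi]
          simp [sphereCoordInfty]
        · obtain ⟨z, hz⟩ := OnePoint.ne_infty_iff_exists.mp hi
          have hz0 : z ≠ 0 := fun h => hx' (by rw [← hz, h])
          have hsz : sphereCoordInfty (R x') = z⁻¹ := by rw [← hz]; rfl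
          rw [hr x' z hz.symm, Function.comp_apply, hsz]
          have : 1 - a * z⁻¹ = (z - a) * z⁻¹ := by field_simp
          rw [this, div_mul_cancel_right₀ (inv_ne_zero hz0)]
      · have hs := hR.mdifferentiableAt_of_ne_infty x hxi
        obtain ⟨z, hz⟩ := OnePoint.ne_infty_iff_exists.mp hxi
        have hsz : sphereCoord (R x) = z := by rw [← hz]; rfl
        have hza : z - a ≠ 0 := fun h => hx (by rw [← hz, sub_eq_zero.mp h])
        have hq : DifferentiableAt ℂ (fun s : ℂ => (s - a)⁻¹) (sphereCoord (R x)) :=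
          (differentiableAt_id.sub_const a).inv (by rw [hsz]; exact hza)
        refine (hq.comp_mdifferentiableAt (f := fun x' => sphereCoord (R x'))
          hs).congr_of_eventuallyEq ?_
        filter_upwards [hR.continuous.continuousAt.eventually_ne hxi] with x' hx'
        obtain ⟨w, hw⟩ := OnePoint.ne_infty_iff_exists.mp hx'
        rw [hr x' w hw.symm, Function.comp_apply, ← hw]; rfl
    -- Stated as a product, the inequality also covers `w = a`, the point missed by `e`.
    · have hc : (e '' Metric.closedBall 0 M)ᶜ = (↑) '' {w : ℂ | M * ‖w - a‖ < 1} := by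
        ext q
        induction q using OnePoint.rec with
        | infty =>
          refine iff_of_false (fun h => h ⟨0, by simpa using hM, he0⟩) ?_
          rintro ⟨w, -, hw⟩
          exact OnePoint.coe_ne_infty _ hw
        | coe w =>
          have key : (w : OnePoint ℂ) ∈ e '' Metric.closedBall 0 M ↔ 1 ≤ M * ‖w - a‖ := by
            constructor
            · rintro ⟨z, hzM, hz⟩
              by_cases hz0 : z = 0
              · rw [hz0, he0] at hz; exact absurd hz (OnePoint.infty_ne_coe _)
              · rw [he z hz0, OnePoint.coe_eq_coe] at hz
                have h1 : 0 < ‖z‖ := norm_pos_iff.mpr hz0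
                rw [← hz, add_sub_cancel_left, norm_inv, ← div_eq_mul_inv, one_le_div h1]
                simpa using hzM
            · intro h
              have hwa : w - a ≠ 0 := by
                intro h0
                rw [h0, norm_zero, mul_zero] at h
                exact absurd h (by norm_num)
              refine ⟨(w - a)⁻¹, ?_, ?_⟩
              · rw [mem_closedBall_zero_iff, norm_inv, inv_le_iff_one_le_mul₀ (norm_pos_iff.mpr hwa)]
                exact h
              · rw [he _ (inv_ne_zero hwa), inv_inv, add_sub_cancel]
          rw [mem_compl_iff, key, not_le]
          constructor
          · exact fun h => ⟨w, h, rfl⟩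
          · rintro ⟨w', hw', hww⟩
            rwa [OnePoint.coe_eq_coe.mp hww] at hw'
      rw [← isOpen_compl_iff, hc, OnePoint.isOpen_image_coe]
      exact isOpen_lt (by fun_prop) continuous_const

end AffineCoordinate

/-! ### Properness and the final reduction. -/

/-- A proper double cover of the plane minus a locally finite set embeds properly into `ℂ²`. -/
theorem IsProperDoubleCover.exists_embedding {X : Type*} [TopologicalSpace X] [T2Space X]
    [ChartedSpace ℂ X] [IsManifold 𝓘(ℂ) ω X] {U V : TopologicalSpace.Opens X} (hUV : U ≤ V)
    {r : V → ℂ} (hr : IsProperDoubleCover r)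
    (hfin : ∀ M : ℝ, ((range (TopologicalSpace.Opens.inclusion hUV))ᶜ ∩
      r ⁻¹' Metric.closedBall 0 M).Finite) :
    ∃ φ : U → ℂ × ℂ, IsProperHolomorphicEmbedding φ := by
  set i := TopologicalSpace.Opens.inclusion hUV with hi
  obtain ⟨h, hm, himm, hinj, hpole⟩ := hr.exists_function_with_poles hfin
  have hmem : ∀ x, i x ∉ (range i)ᶜ := fun x hx => hx (mem_range_self x)
  have him : MDifferentiable 𝓘(ℂ) 𝓘(ℂ) i :=
    (contMDiff_inclusion (n := ω) hUV).mdifferentiable (by simp)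
  have hri : MDifferentiable 𝓘(ℂ) 𝓘(ℂ) (r ∘ i) := hr.mdifferentiable.comp him
  have hhi : MDifferentiable 𝓘(ℂ) 𝓘(ℂ) (h ∘ i) := fun x => (hm _ (hmem x)).comp x (him x)
  have hφ : MDifferentiable 𝓘(ℂ) 𝓘(ℂ, ℂ × ℂ) fun x => ((r ∘ i) x, (h ∘ i) x) :=
    hri.prodMk_space hhi
  have hφinj : Function.Injective fun x => ((r ∘ i) x, (h ∘ i) x) := by
    intro x x' e
    have := hinj _ (hmem x) _ (hmem x') (congrArg Prod.fst e) (congrArg Prod.snd e)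
    exact Set.inclusion_injective hUV this
  have hproper : IsProperMap fun x => ((r ∘ i) x, (h ∘ i) x) := by
    rw [isProperMap_iff_ultrafilter]
    refine ⟨hφ.continuous, fun 𝒰 q hq => ?_⟩
    have hq1 : Tendsto (r ∘ i) 𝒰 (𝓝 q.1) := (continuous_fst.tendsto q).comp hq
    have hq2 : Tendsto (h ∘ i) 𝒰 (𝓝 q.2) := (continuous_snd.tendsto q).comp hq
    have hb1 : ∀ᶠ x in (𝒰 : Filter U), ‖r (i x)‖ ≤ ‖q.1‖ + 1 :=
      hq1.norm.eventually_le_const (lt_add_one _)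
    have hb2 : ∀ᶠ x in (𝒰 : Filter U), ‖h (i x)‖ ≤ ‖q.2‖ + 1 :=
      hq2.norm.eventually_le_const (lt_add_one _)
    -- Bounded `r` makes the ultrafilter converge in the larger surface; bounded `h` keeps its limit
    -- off the removed set.
    obtain ⟨y, -, hy⟩ := isCompact_iff_ultrafilter_le_nhds.mp
      (hr.isCompact_preimage (‖q.1‖ + 1)) (𝒰.map i) (by
        rw [le_principal_iff]
        exact hb1.mono fun x hx => by simpa using hx)
    have hyi : Tendsto i 𝒰 (𝓝 y) := hy
    have hyD : y ∉ (range i)ᶜ := by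
      intro hyD
      obtain ⟨x, hx1, hx2⟩ := ((hyi.eventually (hpole y hyD (‖q.2‖ + 1))).and hb2).exists
      exact (hx1 (hmem x)).not_ge hx2
    obtain ⟨x, rfl⟩ := not_not.mp hyD
    have hx : (𝒰 : Filter U) ≤ 𝓝 x := by
      have hind : IsInducing i := (TopologicalSpace.Opens.isOpenEmbedding_of_le hUV).isInducing
      rw [hind.nhds_eq_comap, ← tendsto_iff_comap]
      exact hyi
    exact ⟨x, tendsto_nhds_unique ((hφ.continuous.tendsto x).mono_left hx) hq, hx⟩
  refine ⟨_, hφ, fun x => mfderiv_prodMk_injective (hri x) (hhi x) ?_,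
    (IsClosedEmbedding.of_continuous_injective_isClosedMap hφ.continuous hφinj
      hproper.isClosedMap).isEmbedding, hproper⟩
  rw [hi, chartDeriv_comp_inclusion, chartDeriv_comp_inclusion]
  exact himm _ (hmem x)

theorem corollary5 {X : Type*} [TopologicalSpace X] [T2Space X] [CompactSpace X]
    [ConnectedSpace X] [ChartedSpace ℂ X] [IsManifold 𝓘(ℂ) ω X]
    (R : X → OnePoint ℂ) (hR : IsTwoToOneCovering R)
    (C : Set X) (hCclosed : IsClosed C) (hCcountable : C.Countable)
    (p : OnePoint ℂ) (hF : R ⁻¹' {p} ⊆ C)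
    (hacc : ∀ a : X, AccPt a (Filter.principal C) → a ∈ R ⁻¹' {p}) :
    ∃ φ : (⟨Cᶜ, hCclosed.isOpen_compl⟩ : TopologicalSpace.Opens X) → ℂ × ℂ,
      IsProperHolomorphicEmbedding φ := by
  obtain ⟨r, e, he, hep, her, hrm, hcl⟩ := hR.holomorphic.exists_affine_coordinate p
  have hRc := hR.holomorphic.continuous
  let U : TopologicalSpace.Opens X := ⟨Cᶜ, hCclosed.isOpen_compl⟩
  let V : TopologicalSpace.Opens X := ⟨(R ⁻¹' {p})ᶜ,
    (isClosed_singleton.preimage hRc).isOpen_compl⟩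
  have hUV : U ≤ V := compl_subset_compl.mpr hF
  have hVp : ∀ x : V, R x ≠ p := fun x => x.2
  have himg : ∀ s : Set ℂ, Subtype.val '' ((fun x : V => r x) ⁻¹' s) = R ⁻¹' (e '' s) := by
    intro s
    ext x
    constructor
    · rintro ⟨x, hx, rfl⟩
      exact ⟨r x, hx, her x (hVp x)⟩
    · rintro ⟨z, hz, hzx⟩
      have hx : R x ≠ p := hzx ▸ hep z
      have : r x = z := he ((her x hx).trans hzx.symm)
      exact ⟨⟨x, hx⟩, by rwa [mem_preimage, this], rfl⟩
  have hKc : ∀ M : ℝ, IsCompact (R ⁻¹' (e '' Metric.closedBall 0 M)) := by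
    intro M
    rcases le_or_gt 0 M with hM | hM
    · exact ((hcl M hM).preimage hRc).isCompact
    · simp [Metric.closedBall_eq_empty.mpr hM]
  have hcard : ∀ z, ((fun x : V => r x) ⁻¹' {z}).ncard = (R ⁻¹' {e z}).ncard := by
    intro z
    rw [← Set.ncard_image_of_injective _ Subtype.val_injective, himg, image_singleton]
  have hr : IsProperDoubleCover fun x : V => r x := by
    refine ⟨fun x => (hrm x (hVp x)).comp x
      ((contMDiff_subtype_val (n := ω)).mdifferentiable (by simp) x), fun M => ?_, fun z => ?_, ?_⟩
    · rw [Subtype.isCompact_iff, himg]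
      exact hKc M
    · rw [hcard]; exact hR.ncard_fibre _
    · simp_rw [hcard]
      exact hR.finite_branch.preimage he.injOn
  refine hr.exists_embedding hUV fun M => ?_
  -- Infinitely many points of `C` over a closed disc would accumulate in its compact preimage,
  -- which is disjoint from `F`.
  by_contra hinf
  have hsub : Subtype.val '' ((range (TopologicalSpace.Opens.inclusion hUV))ᶜ ∩
      (fun x : V => r x) ⁻¹' Metric.closedBall 0 M) ⊆ C ∩ R ⁻¹' (e '' Metric.closedBall 0 M) := by
    rintro _ ⟨x, ⟨hx, hxM⟩, rfl⟩
    refine ⟨by_contra fun hxC => hx ⟨⟨x, hxC⟩, rfl⟩, ?_⟩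
    rw [← himg]
    exact mem_image_of_mem _ hxM
  have hinf' := (Set.Infinite.image Subtype.val_injective.injOn hinf).mono hsub
  obtain ⟨a, ⟨z, -, haz⟩, hacca⟩ := hinf'.exists_accPt_of_subset_isCompact (hKc M) inter_subset_right
  have : R a = p := hacc a (hacca.mono (principal_mono.mpr inter_subset_left))
  exact hep z (haz.trans this)
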